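/- Let $N\ge 3$ be an integer, let $\beta<N-2$, $b\ge 0$ and $m>0$ be real numbers, and let $d\mu=|x|^{-\beta}e^{-b|x|^m}\,dx$ on $\mathbb{R}^N$. Let $H^1_\mu$ be the space of real functions $u\in L^2(\mathbb{R}^N,d\mu)$ that have a weak gradient $\nabla u$ (tested against $C_c^\infty(\mathbb{R}^N\setminus\{0\})$) with $|\nabla u|\in L^2(\mathbb{R}^N,d\mu)$, and put $c_0(N-\beta)=\left(\frac{N-\beta-2}{2}\right)^2$. Then there is a constant $C\ge 0$ (depending only on $N,\beta,b,m$) such that for all $u\in H^1_\mu$ the function $u^2/|x|^2$ is $\mu$-integrable and $$c_0(N-\beta)\int_{\mathbb{R}^N}\frac{u^2}{|x|^2}\,d\mu\le\int_{\mathbb{R}^N}|\nabla u|^2\,d\mu+C\int_{\mathbb{R}^N}u^2\,d\mu .$$ The constant $c_0(N-\beta)$ is the best possible: for every $c>c_0(N-\beta)$ and every $C\in\mathbb{R}$ there is $u\in H^1_\mu$, which can even be taken in $C_c^\infty(\mathbb{R}^N)$, such that $$c\int_{\mathbb{R}^N}\frac{u^2}{|x|^2}\,d\mu>\int_{\mathbb{R}^N}|\nabla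 u|^2\,d\mu+C\int_{\mathbb{R}^N}u^2\,d\mu .$$ -/

import Mathlib

open MeasureTheory

noncomputable section

/-- The measure `|x|^(-β) * exp (-b * |x|^m) dx` on `ℝ^N`. -/
def weightMeasure (N : ℕ) (β b m : ℝ) : Measure (EuclideanSpace ℝ (Fin N)) :=
  volume.withDensity fun x => ENNReal.ofReal (‖x‖ ^ (-β) * Real.exp (-b * ‖x‖ ^ m))

/-- `g` is the weak gradient of `u` on the open set `Ω ⊆ ℝ^N`: both are locally integrable on `Ω`
with respect to Lebesgue measure and
`∫ u ∂_v φ dx = - ∫ ⟨g, v⟩ φ dx` for all `φ ∈ C_c^∞(Ω)` and all directions `v`. -/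
structure HasWeakGradientOn {N : ℕ} (Ω : Set (EuclideanSpace ℝ (Fin N)))
    (u : EuclideanSpace ℝ (Fin N) → ℝ)
    (g : EuclideanSpace ℝ (Fin N) → EuclideanSpace ℝ (Fin N)) : Prop where
  locallyIntegrableOn : LocallyIntegrableOn u Ω volume
  locallyIntegrableOn_grad : LocallyIntegrableOn g Ω volume
  integral_eq : ∀ φ : EuclideanSpace ℝ (Fin N) → ℝ,
    ContDiff ℝ (⊤ : ℕ∞) φ → HasCompactSupport φ → tsupport φ ⊆ Ω →
    ∀ v : EuclideanSpace ℝ (Fin N),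
      ∫ x, u x * fderiv ℝ φ x v = - ∫ x, inner ℝ (g x) v * φ x

/-- `u` belongs to the weighted Sobolev space `H^1_μ` and `g` is its weak gradient: `u` and `g` are
in `L^2_μ`. Derivatives are taken on `ℝ^N \ {0}`, where the weights in question are smooth and
positive, so that functions in `L^2_μ` are locally integrable there whatever `β` is. -/
structure MemWeightedH1 {N : ℕ} (μ : Measure (EuclideanSpace ℝ (Fin N)))
    (u : EuclideanSpace ℝ (Fin N) → ℝ)
    (g : EuclideanSpace ℝ (Fin N) → EuclideanSpace ℝ (Fin N)) : Prop where
  memLp : MemLp u 2 μ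
  memLp_grad : MemLp g 2 μ
  hasWeakGradientOn : HasWeakGradientOn {0}ᶜ u g

/-- The constant `c_0(s) = ((s - 2) / 2)^2`. -/
def hardyConst (s : ℝ) : ℝ := ((s - 2) / 2) ^ 2

end

/-! Write `w(r) = r^(-β) exp(-b r^m)` and `l = (N - β - 2) / 2`, so that the Hardy constant is `l²`.

The inequality comes from a vector field. For `k` supported in a compact subset of `(0, ∞)`,
integrate `u²` by parts against `k(|x|) x`, whose divergence is `N k + r k'`, and complete the
square in the gradient: `∫ u² (N k + r k' - (k r)² / w) ≤ ∫ w |∇u|²`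
(`HasWeakGradientOn.integral_sq_mul_le`). With `k = w r^(-2) h` the bracket becomes `w r^(-2) ((2l -
b m r^m) h + r h' - h²)`. If `b = 0`, the constant `h = l` gives exactly `l²`. In general `h = l + a
r^m` near the origin absorbs the exponential, and cutting `h` off at large radii costs only a term
`K r²`, which becomes `K ∫ u² dμ` (`exists_hardy_profile`). A cutoff near the origin is removed by
Fatou's lemma. Integration by parts for a merely weak gradient needs `∇(u²) = 2 u ∇u`, which is
proved by mollification (`HasWeakGradientOn.integral_sq_mul_fderiv`).

For optimality take `u = |x|^(-l) φ(log |x|)`. In `t = log r`, up to a common factor and the weight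
`exp(-b e^(mt))`, the three integrals are those of `(φ' - l φ)²`, `φ²` and `e^(2t) φ²`. Stretching a
fixed bump by `L` and placing it in `[-2L, -L]` makes `φ'` and `e^(2t)` negligible and the weight
close to `1`, so the quotient tends to `l²` (`exists_log_profile`). -/

/-! ### Weak convergence of mollifications in `L²`. -/

section Mollification

open Filter Topology Convolution ContinuousLinearMap

variable {E : Type*} [NormedAddCommGroup E] [InnerProductSpace ℝ E] [FiniteDimensional ℝ E]
  [MeasurableSpace E] [BorelSpace E]

/-- The correlation of two square integrable functions is continuous. -/
theorem continuous_integral_mul_translate {f h : E → ℝ} (hf : MemLp f 2) (hh : MemLp h 2) :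
    Continuous fun y => ∫ x, f x * h (x + y) := by
  let T : C(E, C(E, E)) := (ContinuousMap.mk (fun a : E × E => a.2 + a.1)
    (continuous_snd.add continuous_fst)).curry
  have hT : ∀ y, MeasurePreserving (T y) (volume : Measure E) volume := fun y =>
    measurePreserving_add_right volume y
  -- Translations act continuously on `L²`, so the correlation is an inner product with a continuous
  -- curve.
  have hc : Continuous fun y => Lp.compMeasurePreserving (T y) (hT y) (hh.toLp h) :=
    continuous_const.compMeasurePreservingLp T.continuous hT (by simp)
  have h2 : Continuous fun y => inner ℝ (Lp.compMeasurePreserving (T y) (hT y) (hh.toLp h))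
      (hf.toLp f) := hc.inner continuous_const
  convert h2 using 2 with y
  rw [L2.inner_def]
  refine integral_congr_ae ?_
  have h3 : Lp.compMeasurePreserving (T y) (hT y) (hh.toLp h) =ᵐ[volume] fun x => h (x + y) :=
    (Lp.coeFn_compMeasurePreserving _ (hT y)).trans
      ((hT y).quasiMeasurePreserving.ae_eq_comp hh.coeFn_toLp)
  filter_upwards [h3, hf.coeFn_toLp] with x hx hx'
  rw [hx, hx']
  simp

/-- By Fubini, pairing with a mollification amounts to mollifying the correlation of `f` and `h` at
`0`. Weak convergence thereby reduces to continuity of the correlation at one point. -/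
theorem integral_mul_convolution {η f h : E → ℝ} (hη : Continuous η) (hη' : HasCompactSupport η)
    (hη0 : ∀ x, 0 ≤ η x) (hf : MemLp f 2) (hh : MemLp h 2) :
    ∫ x, f x * (η ⋆[lsmul ℝ ℝ, volume] h) x =
      (η ⋆[lsmul ℝ ℝ, volume] fun y => ∫ x, f x * h (x + y)) 0 := by
  have hηi : Integrable η := hη.integrable_of_hasCompactSupport hη'
  have hF2 : Integrable fun x => f x ^ 2 := hf.integrable_sq
  have hH2 : Integrable fun x => h x ^ 2 := hh.integrable_sq
  have h1 : Integrable (fun p : E × E => f p.1 ^ 2 * η p.2) (volume.prod volume) :=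
    hF2.mul_prod hηi
  have h2 : Integrable (fun p : E × E => η p.2 * h (p.1 - p.2) ^ 2) (volume.prod volume) := by
    simpa using hηi.convolution_integrand (lsmul ℝ ℝ) hH2
  have h3 : AEStronglyMeasurable (fun p : E × E => η p.2 * h (p.1 - p.2)) (volume.prod volume) := by
    simpa using hη.aestronglyMeasurable.convolution_integrand (lsmul ℝ ℝ) hh.1
  -- Fubini is justified by `|f η h| ≤ f² η + η h²`, both terms on the right being integrable on the
  -- product.
  have hI : Integrable (fun p : E × E => f p.1 * (η p.2 * h (p.1 - p.2)))
      (volume.prod volume) := by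
    refine (h1.add h2).mono (hf.1.comp_fst.mul h3) (Eventually.of_forall fun p => ?_)
    simp only [Pi.add_apply, Real.norm_eq_abs]
    have e := hη0 p.2
    rw [abs_of_nonneg (a := f p.1 ^ 2 * η p.2 + _) (by positivity), abs_mul, abs_mul,
      abs_of_nonneg e]
    have := sq_nonneg (|f p.1| - |h (p.1 - p.2)|)
    rw [← sq_abs (f p.1), ← sq_abs (h (p.1 - p.2))]
    nlinarith [mul_nonneg e (mul_nonneg (abs_nonneg (f p.1)) (abs_nonneg (h (p.1 - p.2))))]
  simp only [convolution, lsmul_apply, smul_eq_mul, zero_sub]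
  simp_rw [← integral_const_mul]
  rw [integral_integral_swap hI]
  refine integral_congr_ae (Eventually.of_forall fun y => ?_)
  refine integral_congr_ae (Eventually.of_forall fun x => ?_)
  simp only [← sub_eq_add_neg]
  ring

/-- Mollification converges weakly in `L²`. -/
theorem tendsto_integral_mul_convolution {φ : ℕ → ContDiffBump (0 : E)}
    (hφ : Tendsto (fun n => (φ n).rOut) atTop (𝓝 0)) {f h : E → ℝ} (hf : MemLp f 2)
    (hh : MemLp h 2) :
    Tendsto (fun n => ∫ x, f x * ((φ n).normed volume ⋆[lsmul ℝ ℝ, volume] h) x) atTop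
      (𝓝 (∫ x, f x * h x)) := by
  have := ContDiffBump.convolution_tendsto_right_of_continuous (μ := volume) hφ
    (continuous_integral_mul_translate hf hh) 0
  simp only [add_zero] at this
  refine this.congr fun n => ?_
  rw [integral_mul_convolution (φ n).continuous_normed (φ n).hasCompactSupport_normed
    (φ n).nonneg_normed hf hh]

end Mollification

/-! ### The chain rule for the square of a weakly differentiable function. -/

section ProductRule

open Filter Topology Convolution ContinuousLinearMap

theorem MeasureTheory.MemLp.mul_continuous_hasCompactSupport {E : Type*} [TopologicalSpace E]
    [MeasurableSpace E] [OpensMeasurableSpace E] {μ : Measure E} {p : ENNReal} {f ψ : E → ℝ}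
    (hf : MemLp f p μ) (hψ : Continuous ψ) (hc : HasCompactSupport ψ) :
    MemLp (fun x => f x * ψ x) p μ := by
  obtain ⟨C, hC⟩ := hψ.bounded_above_of_compact_support hc
  refine hf.of_le_mul (c := C) (hf.1.mul hψ.aestronglyMeasurable)
    (Eventually.of_forall fun x => ?_)
  rw [norm_mul, mul_comm]
  exact mul_le_mul_of_nonneg_right (hC x) (norm_nonneg _)

variable {N : ℕ}

local notation "𝔼" => EuclideanSpace ℝ (Fin N)

theorem convolution_lsmul_comm (f h : 𝔼 → ℝ) :
    f ⋆[lsmul ℝ ℝ, volume] h = h ⋆[lsmul ℝ ℝ, volume] f := by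
  ext x
  rw [convolution_eq_swap]
  simp [convolution, mul_comm]

/-- The derivative of a mollification is the mollification of the weak gradient. -/
theorem HasWeakGradientOn.fderiv_convolution {Ω K : Set 𝔼} {u : 𝔼 → ℝ} {g : 𝔼 → 𝔼}
    (hw : HasWeakGradientOn Ω u g) (hKΩ : K ⊆ Ω) (hU : LocallyIntegrable (K.indicator u))
    (φ : ContDiffBump (0 : 𝔼)) {x : 𝔼} (hx : Metric.closedBall x φ.rOut ⊆ K) (v : 𝔼) :
    fderiv ℝ (φ.normed volume ⋆[lsmul ℝ ℝ, volume] K.indicator u) x v =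
      (φ.normed volume ⋆[lsmul ℝ ℝ, volume] K.indicator fun y => inner ℝ (g y) v) x := by
  set η : 𝔼 → ℝ := φ.normed volume with hη
  have hηs : ContDiff ℝ (⊤ : ℕ∞) η := φ.contDiff_normed
  have hηc : HasCompactSupport η := φ.hasCompactSupport_normed
  -- The kernel centred at `x` vanishes off `K`, so truncating `u` and `g` to `K` changes neither
  -- side.
  have hηz : ∀ y, y ∉ K → η (x - y) = 0 ∧ fderiv ℝ η (x - y) = 0 := by
    intro y hy
    have : x - y ∉ tsupport η := by
      rw [hη, φ.tsupport_normed_eq]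
      intro h
      apply hy
      apply hx
      rw [Metric.mem_closedBall, dist_comm, dist_eq_norm]
      simpa using h
    refine ⟨image_eq_zero_of_notMem_tsupport this, ?_⟩
    exact image_eq_zero_of_notMem_tsupport fun h => this (tsupport_fderiv_subset ℝ h)
  rw [convolution_lsmul_comm, convolution_lsmul_comm η]
  have h1 : ContDiff ℝ 1 η := hηs.of_le (by exact_mod_cast le_top)
  rw [(hηc.hasFDerivAt_convolution_right (lsmul ℝ ℝ) hU h1 x).fderiv,
    convolution_precompR_apply _ hU (hηc.fderiv ℝ) (h1.continuous_fderiv one_ne_zero)]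
  have hd : ∀ y, HasFDerivAt (fun y => η (x - y)) (-(fderiv ℝ η (x - y))) y := by
    intro y
    have h2 : HasFDerivAt η (fderiv ℝ η (x - y)) (x - y) :=
      (h1.differentiable one_ne_zero).differentiableAt.hasFDerivAt
    convert! h2.comp y ((hasFDerivAt_id y).const_sub x) using 1
    ext; simp
  have key := hw.integral_eq (fun y => η (x - y)) (hηs.comp (contDiff_const.sub contDiff_id))
    (hηc.comp_homeomorph (Homeomorph.subLeft x)) ?_ v
  · simp only [convolution, lsmul_apply, smul_eq_mul]
    calc ∫ t, K.indicator u t * fderiv ℝ η (x - t) v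
        = - ∫ t, u t * fderiv ℝ (fun y => η (x - y)) t v := by
          rw [← integral_neg]
          congr 1; ext t
          rw [(hd t).fderiv]
          by_cases ht : t ∈ K
          · simp [ht]
          · simp [ht, (hηz t ht).2]
      _ = ∫ t, inner ℝ (g t) v * η (x - t) := by rw [key, neg_neg]
      _ = _ := by
          congr 1; ext t
          by_cases ht : t ∈ K
          · simp [ht]
          · simp [ht, (hηz t ht).1]
  · refine (closure_minimal ?_ Metric.isClosed_closedBall).trans (hx.trans hKΩ)
    intro y hy
    have : x - y ∈ Function.support η := hy
    rw [hη, φ.support_normed_eq] at this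
    rw [Metric.mem_closedBall, dist_comm, dist_eq_norm]
    have h3 : ‖x - y‖ < φ.rOut := by simpa using this
    exact h3.le

/-- The chain rule `∇(u²) = 2 u ∇u` in weak form. -/
theorem HasWeakGradientOn.integral_sq_mul_fderiv {Ω : Set 𝔼} (hΩ : IsOpen Ω) {u : 𝔼 → ℝ}
    {g : 𝔼 → 𝔼} (hw : HasWeakGradientOn Ω u g)
    (hu : ∀ K ⊆ Ω, IsCompact K → MemLp u 2 (volume.restrict K))
    (hg : ∀ K ⊆ Ω, IsCompact K → MemLp g 2 (volume.restrict K))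
    {ψ : 𝔼 → ℝ} (hψ : ContDiff ℝ (⊤ : ℕ∞) ψ) (hc : HasCompactSupport ψ) (hs : tsupport ψ ⊆ Ω)
    (v : 𝔼) :
    ∫ x, u x ^ 2 * fderiv ℝ ψ x v = -(2 * ∫ x, u x * inner ℝ (g x) v * ψ x) := by
  -- `K` leaves a margin `δ` around the support of `ψ`. Mollifying the truncations to `K` at scales
  -- below `δ` then commutes with differentiation on that support.
  obtain ⟨K, hK, hψK, hKΩ⟩ := exists_compact_between hc hΩ hs
  obtain ⟨δ, hδ, hδK⟩ := IsCompact.exists_cthickening_subset_open hc isOpen_interior hψK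
  have hball : ∀ x ∈ tsupport ψ, Metric.closedBall x δ ⊆ K := fun x hx =>
    (Metric.closedBall_subset_cthickening hx δ).trans (hδK.trans interior_subset)
  set U : 𝔼 → ℝ := K.indicator u with hUdef
  set G : 𝔼 → ℝ := K.indicator fun y => inner ℝ (g y) v with hGdef
  have hU : MemLp U 2 := (memLp_indicator_iff_restrict hK.measurableSet).2 (hu K hKΩ hK)
  have hG : MemLp G 2 :=
    (memLp_indicator_iff_restrict hK.measurableSet).2 ((hg K hKΩ hK).inner_const v)
  have hUl : LocallyIntegrable U := hU.locallyIntegrable (by norm_num)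
  have hGl : LocallyIntegrable G := hG.locallyIntegrable (by norm_num)
  have hGc : HasCompactSupport G := HasCompactSupport.intro hK fun x hx => by simp [hGdef, hx]
  have hUc : HasCompactSupport U := HasCompactSupport.intro hK fun x hx => by simp [hUdef, hx]
  let φ : ℕ → ContDiffBump (0 : 𝔼) := fun n =>
    ⟨δ / (n + 1) / 2, δ / (n + 1), by positivity, half_lt_self (by positivity)⟩
  have hφ : Tendsto (fun n => (φ n).rOut) atTop (𝓝 0) := by
    have := (tendsto_const_nhds (x := δ)).mul tendsto_one_div_add_atTop_nhds_zero_nat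
    rw [mul_zero] at this
    refine this.congr fun n => ?_
    change _ = δ / (n + 1)
    ring
  have hφδ : ∀ n, (φ n).rOut ≤ δ := fun n =>
    div_le_self hδ.le (by have : (0 : ℝ) ≤ n := n.cast_nonneg; linarith)
  have hψc : Continuous ψ := hψ.continuous
  have hDψc : Continuous fun x => fderiv ℝ ψ x v :=
    (hψ.continuous_fderiv (by simp)).clm_apply continuous_const
  have hDψs : HasCompactSupport fun x => fderiv ℝ ψ x v := hc.fderiv_apply ℝ v
  have hf1 : MemLp (fun x => U x * ψ x) 2 := hU.mul_continuous_hasCompactSupport hψc hc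
  have hf2 : MemLp (fun x => U x * fderiv ℝ ψ x v) 2 :=
    hU.mul_continuous_hasCompactSupport hDψc hDψs
  have hf3 : MemLp (fun x => G x * ψ x) 2 := hG.mul_continuous_hasCompactSupport hψc hc
  have hconv : ∀ n, ∀ V : 𝔼 → ℝ, LocallyIntegrable V → HasCompactSupport V →
      MemLp ((φ n).normed volume ⋆[lsmul ℝ ℝ, volume] V) 2 := fun n V hV hVc =>
    ((φ n).hasCompactSupport_normed.continuous_convolution_left (lsmul ℝ ℝ)
      (φ n).continuous_normed hV).memLp_of_hasCompactSupport
      ((φ n).hasCompactSupport_normed.convolution _ hVc)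
  -- This is the weak gradient identity tested with `(φ n * U) ψ`. Each integral is linear in a
  -- mollified function, so weak convergence suffices in the limit.
  have hid : ∀ n, (∫ x, (U x * ψ x) * ((φ n).normed volume ⋆[lsmul ℝ ℝ, volume] G) x) +
      ∫ x, (U x * fderiv ℝ ψ x v) * ((φ n).normed volume ⋆[lsmul ℝ ℝ, volume] U) x =
      - ∫ x, (G x * ψ x) * ((φ n).normed volume ⋆[lsmul ℝ ℝ, volume] U) x := by
    intro n
    have hcs : ContDiff ℝ (⊤ : ℕ∞) ((φ n).normed volume ⋆[lsmul ℝ ℝ, volume] U) :=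
      (φ n).hasCompactSupport_normed.contDiff_convolution_left _ (φ n).contDiff_normed hUl
    have := hw.integral_eq
      (fun x => ((φ n).normed volume ⋆[lsmul ℝ ℝ, volume] U) x * ψ x) (hcs.mul hψ)
      hc.mul_left ((tsupport_mul_subset_right).trans hs) v
    refine (integral_add (hf1.integrable_mul (hconv n G hGl hGc))
      (hf2.integrable_mul (hconv n U hUl hUc))).symm.trans ?_
    convert this using 2
    · ext x
      rw [fderiv_fun_mul (hcs.differentiable (by simp)).differentiableAt
        (hψ.differentiable (by simp)).differentiableAt]
      by_cases hx : x ∈ tsupport ψ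
      · have hxK : x ∈ K := interior_subset (hψK hx)
        have hUx : U x = u x := Set.indicator_of_mem hxK u
        have : fderiv ℝ ((φ n).normed volume ⋆[lsmul ℝ ℝ, volume] U) x v =
            ((φ n).normed volume ⋆[lsmul ℝ ℝ, volume] G) x :=
          hw.fderiv_convolution hKΩ hUl (φ n) ((Metric.closedBall_subset_closedBall
            (hφδ n)).trans (hball x hx)) v
        simp only [add_apply, smul_apply, smul_eq_mul, Pi.mul_apply]
        rw [this, hUx]
        ring
      · have h0 : ψ x = 0 := image_eq_zero_of_notMem_tsupport hx
        have h1 : fderiv ℝ ψ x = 0 :=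
          image_eq_zero_of_notMem_tsupport fun h => hx (tsupport_fderiv_subset ℝ h)
        simp [h0, h1]
    · congr 1
      ext x
      by_cases hx : x ∈ tsupport ψ
      · have hxK : x ∈ K := interior_subset (hψK hx)
        simp only [hGdef, Set.indicator_of_mem hxK]
        ring
      · have h0 : ψ x = 0 := image_eq_zero_of_notMem_tsupport hx
        simp [h0]
  have hlim := tendsto_nhds_unique
    (((tendsto_integral_mul_convolution hφ hf1 hG).add
      (tendsto_integral_mul_convolution hφ hf2 hU)).congr hid)
    (tendsto_integral_mul_convolution hφ hf3 hU).neg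
  have e1 : ∫ x, U x * ψ x * G x = ∫ x, u x * inner ℝ (g x) v * ψ x := by
    congr 1; ext x
    by_cases hx : x ∈ K
    · simp only [hUdef, hGdef, Set.indicator_of_mem hx]; ring
    · have h0 : ψ x = 0 := image_eq_zero_of_notMem_tsupport fun h => hx (interior_subset (hψK h))
      simp [h0]
  have e2 : ∫ x, G x * ψ x * U x = ∫ x, u x * inner ℝ (g x) v * ψ x := by
    rw [← e1]; congr 1; ext x; ring
  have e3 : ∫ x, U x * fderiv ℝ ψ x v * U x = ∫ x, u x ^ 2 * fderiv ℝ ψ x v := by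
    congr 1; ext x
    by_cases hx : x ∈ K
    · simp only [hUdef, Set.indicator_of_mem hx]; ring
    · have h1 : fderiv ℝ ψ x = 0 := image_eq_zero_of_notMem_tsupport fun h =>
        hx (interior_subset (hψK (tsupport_fderiv_subset ℝ h)))
      simp [h1]
  rw [e1, e2, e3] at hlim
  linarith

end ProductRule

/-! ### Integration by parts against radial fields and completion of the square. -/

section Radial

open Filter Topology Convolution ContinuousLinearMap

theorem integrable_mul_of_integrableOn_tsupport {E : Type*} [TopologicalSpace E]
    [MeasurableSpace E] [OpensMeasurableSpace E] {μ : Measure E} {f F : E → ℝ}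
    (hf : IntegrableOn f (tsupport F) μ) (hF : Continuous F) (hc : HasCompactSupport F) :
    Integrable (fun x => f x * F x) μ := by
  have h1 : MemLp ((tsupport F).indicator f) 1 μ := memLp_one_iff_integrable.2
    ((integrable_indicator_iff (isClosed_tsupport F).measurableSet).2 hf)
  refine (memLp_one_iff_integrable.1 (h1.mul_continuous_hasCompactSupport hF hc)).congr
    (Eventually.of_forall fun x => ?_)
  by_cases hx : x ∈ tsupport F
  · simp [hx]
  · simp [image_eq_zero_of_notMem_tsupport hx]

theorem tsupport_subset_of_forall_norm {E : Type*} [NormedAddCommGroup E] {F : E → ℝ} {δ R : ℝ}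
    (h0 : ∀ x, ‖x‖ < δ → F x = 0) (h1 : ∀ x, R < ‖x‖ → F x = 0) :
    tsupport F ⊆ {x | δ ≤ ‖x‖ ∧ ‖x‖ ≤ R} := by
  refine closure_minimal (fun x hx => ⟨?_, ?_⟩) ((isClosed_le continuous_const continuous_norm).inter
    (isClosed_le continuous_norm continuous_const))
  · by_contra! h
    exact hx (h0 x h)
  · by_contra! h
    exact hx (h1 x h)

/-- Vanishing below `δ` hides any singularity of the profile at `0`; this is how negative powers of
the radius are handled throughout. -/
theorem continuous_comp_norm_of_continuousOn {E : Type*} [NormedAddCommGroup E] {F : ℝ → ℝ}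
    (hF : ContinuousOn F (Set.Ioi 0)) {δ : ℝ} (hδ : 0 < δ) (h0 : ∀ r < δ, F r = 0) :
    Continuous fun x : E => F ‖x‖ := by
  have : Continuous F := by
    rw [continuous_iff_continuousAt]
    intro r
    rcases lt_or_ge r δ with h1 | h1
    · have h2 : F =ᶠ[𝓝 r] fun _ => 0 := by
        filter_upwards [Iio_mem_nhds h1] with s hs using h0 s hs
      exact continuousAt_const.congr h2.symm
    · exact hF.continuousAt (Ioi_mem_nhds (hδ.trans_le h1))
  exact this.comp continuous_norm

variable {E : Type*} [NormedAddCommGroup E] [InnerProductSpace ℝ E]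

theorem hasCompactSupport_of_forall_norm [FiniteDimensional ℝ E] {F : E → ℝ} {R : ℝ}
    (h1 : ∀ x, R < ‖x‖ → F x = 0) : HasCompactSupport F :=
  HasCompactSupport.intro (isCompact_closedBall (0 : E) R) fun x hx => h1 x (by simpa using hx)

theorem contDiff_comp_norm {k : ℝ → ℝ} {n : WithTop ℕ∞} (hk : ContDiff ℝ n k) {δ : ℝ} (hδ : 0 < δ)
    (h0 : ∀ r < δ, k r = 0) : ContDiff ℝ n fun x : E => k ‖x‖ := by
  rw [contDiff_iff_contDiffAt]
  intro x
  by_cases hx : x = 0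
  · subst hx
    have : (fun x : E => k ‖x‖) =ᶠ[𝓝 0] fun _ => 0 := by
      filter_upwards [Metric.ball_mem_nhds (0 : E) hδ] with x hx
      exact h0 _ (by simpa using hx)
    exact contDiffAt_const.congr_of_eventuallyEq this
  · exact hk.contDiffAt.comp x (contDiffAt_norm ℝ hx)

theorem fderiv_comp_norm {k : ℝ → ℝ} (hk : Differentiable ℝ k) {δ : ℝ} (hδ : 0 < δ)
    (h0 : ∀ r < δ, k r = 0) (x v : E) :
    fderiv ℝ (fun x : E => k ‖x‖) x v = deriv k ‖x‖ / ‖x‖ * inner ℝ x v := by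
  by_cases hx : x = 0
  · subst hx
    have : (fun x : E => k ‖x‖) =ᶠ[𝓝 0] fun _ => 0 := by
      filter_upwards [Metric.ball_mem_nhds (0 : E) hδ] with x hx
      exact h0 _ (by simpa using hx)
    rw [this.fderiv_eq]
    simp
  · have h1 : HasFDerivAt (fun x : E => ‖x‖ ^ 2) (2 • innerSL ℝ x) x :=
      (hasStrictFDerivAt_norm_sq x).hasFDerivAt
    have h2 : HasFDerivAt (fun x : E => ‖x‖) (‖x‖⁻¹ • innerSL ℝ x) x := by
      have h3 := h1.sqrt (by simpa using hx)
      simp only [Real.sqrt_sq (norm_nonneg _)] at h3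
      convert! h3 using 1
      ext v
      simp
      field_simp
    have h4 := (hk ‖x‖).hasDerivAt.comp_hasFDerivAt x h2
    have h5 : fderiv ℝ (fun x : E => k ‖x‖) x = deriv k ‖x‖ • ‖x‖⁻¹ • innerSL ℝ x := h4.fderiv
    rw [h5]
    simp
    ring

variable {N : ℕ}

local notation "𝔼" => EuclideanSpace ℝ (Fin N)

/-- Integration by parts of `u²` against the radial vector field `k(|x|) x`. -/
theorem HasWeakGradientOn.integral_sq_mul_radial {u : 𝔼 → ℝ} {g : 𝔼 → 𝔼}
    (hw : HasWeakGradientOn {0}ᶜ u g)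
    (hu : ∀ K ⊆ ({0}ᶜ : Set 𝔼), IsCompact K → MemLp u 2 (volume.restrict K))
    (hg : ∀ K ⊆ ({0}ᶜ : Set 𝔼), IsCompact K → MemLp g 2 (volume.restrict K))
    {k : ℝ → ℝ} (hk : ContDiff ℝ (⊤ : ℕ∞) k) {δ R : ℝ} (hδ : 0 < δ)
    (h0 : ∀ r < δ, k r = 0) (h1 : ∀ r, R < r → k r = 0) :
    Integrable (fun x => u x ^ 2 * (N * k ‖x‖ + ‖x‖ * deriv k ‖x‖)) ∧
    Integrable (fun x => u x * inner ℝ (g x) x * k ‖x‖) ∧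
    ∫ x, u x ^ 2 * (N * k ‖x‖ + ‖x‖ * deriv k ‖x‖) =
      -(2 * ∫ x, u x * inner ℝ (g x) x * k ‖x‖) := by
  -- These are the components of the field `k(|x|) x`. The chain rule is applied to `ψ i` in
  -- direction `e i`, and the sum over `i` produces the divergence.
  let ψ : Fin N → 𝔼 → ℝ := fun i x => k ‖x‖ * x i
  let e : Fin N → 𝔼 := fun i => EuclideanSpace.single i 1
  have hcoord : ∀ i, ContDiff ℝ (⊤ : ℕ∞) fun x : 𝔼 => x i := fun i =>
    (EuclideanSpace.proj (𝕜 := ℝ) i : 𝔼 →L[ℝ] ℝ).contDiff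
  have hks : ContDiff ℝ (⊤ : ℕ∞) fun x : 𝔼 => k ‖x‖ := contDiff_comp_norm hk hδ h0
  have hψ : ∀ i, ContDiff ℝ (⊤ : ℕ∞) (ψ i) := fun i => hks.mul (hcoord i)
  have hψ0 : ∀ i x, ‖x‖ < δ → ψ i x = 0 := fun i x hx => by simp [ψ, h0 _ hx]
  have hψ1 : ∀ i x, R < ‖x‖ → ψ i x = 0 := fun i x hx => by simp [ψ, h1 _ hx]
  have hA : {x : 𝔼 | δ ≤ ‖x‖ ∧ ‖x‖ ≤ R} ⊆ {0}ᶜ := by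
    rintro x ⟨hx, -⟩ rfl
    simp at hx; linarith
  have hψs : ∀ i, tsupport (ψ i) ⊆ {0}ᶜ := fun i =>
    (tsupport_subset_of_forall_norm (hψ0 i) (hψ1 i)).trans hA
  have hψc : ∀ i, HasCompactSupport (ψ i) := fun i => hasCompactSupport_of_forall_norm (hψ1 i)
  have hder : ∀ i x, fderiv ℝ (ψ i) x (e i) = deriv k ‖x‖ / ‖x‖ * x i ^ 2 + k ‖x‖ := by
    intro i x
    have h2 : fderiv ℝ (fun x : 𝔼 => x i) x = (EuclideanSpace.proj (𝕜 := ℝ) i : 𝔼 →L[ℝ] ℝ) :=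
      (EuclideanSpace.proj (𝕜 := ℝ) i : 𝔼 →L[ℝ] ℝ).fderiv
    change fderiv ℝ (fun x : 𝔼 => k ‖x‖ * x i) x (e i) = _
    rw [fderiv_fun_mul (hks.differentiable (by simp)).differentiableAt
      ((hcoord i).differentiable (by simp)).differentiableAt, h2]
    simp only [add_apply, smul_apply, smul_eq_mul]
    rw [fderiv_comp_norm (hk.differentiable (by simp)) hδ h0]
    simp [e, EuclideanSpace.inner_single_right]
    ring
  have hsum1 : ∀ x : 𝔼, ∑ i, u x ^ 2 * fderiv ℝ (ψ i) x (e i) =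
      u x ^ 2 * (N * k ‖x‖ + ‖x‖ * deriv k ‖x‖) := by
    intro x
    simp_rw [hder]
    rw [← Finset.mul_sum, Finset.sum_add_distrib, ← Finset.mul_sum]
    have : ∑ i, x i ^ 2 = ‖x‖ ^ 2 := by rw [EuclideanSpace.real_norm_sq_eq]
    rw [this]
    simp only [Finset.sum_const, Finset.card_univ, Fintype.card_fin, nsmul_eq_mul]
    by_cases hx : ‖x‖ = 0
    · simp [hx]
    · field_simp; ring
  have hsum2 : ∀ x : 𝔼, ∑ i, u x * inner ℝ (g x) (e i) * ψ i x =
      u x * inner ℝ (g x) x * k ‖x‖ := by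
    intro x
    have : inner ℝ (g x) x = ∑ i, g x i * x i := by
      simp [PiLp.inner_apply, mul_comm]
    rw [this, Finset.mul_sum, Finset.sum_mul]
    refine Finset.sum_congr rfl fun i _ => ?_
    simp [e, ψ, EuclideanSpace.inner_single_right]
    ring
  have hI1 : ∀ i, Integrable fun x => u x ^ 2 * fderiv ℝ (ψ i) x (e i) := by
    intro i
    have hs : tsupport (fun x => fderiv ℝ (ψ i) x (e i)) ⊆ tsupport (ψ i) :=
      closure_minimal (fun x hx => tsupport_fderiv_subset ℝ (f := ψ i)
        (subset_tsupport _ fun h => hx (by simp [h]))) (isClosed_tsupport _)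
    have hc := (hψc i).fderiv_apply ℝ (e i)
    exact integrable_mul_of_integrableOn_tsupport (hu _ (hs.trans (hψs i)) hc).integrable_sq
      (((hψ i).continuous_fderiv (by simp)).clm_apply continuous_const) hc
  have hI2 : ∀ i, Integrable fun x => u x * inner ℝ (g x) (e i) * ψ i x := by
    intro i
    exact integrable_mul_of_integrableOn_tsupport
      ((hu _ (hψs i) (hψc i)).integrable_mul ((hg _ (hψs i) (hψc i)).inner_const (e i)))
      (hψ i).continuous (hψc i)
  refine ⟨(integrable_finsetSum _ fun i _ => hI1 i).congr (Eventually.of_forall hsum1),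
    (integrable_finsetSum _ fun i _ => hI2 i).congr (Eventually.of_forall hsum2), ?_⟩
  simp_rw [← hsum1, ← hsum2]
  rw [integral_finsetSum _ fun i _ => hI1 i, integral_finsetSum _ fun i _ => hI2 i,
    Finset.mul_sum, ← Finset.sum_neg_distrib]
  exact Finset.sum_congr rfl fun i _ =>
    hw.integral_sq_mul_fderiv isOpen_compl_singleton hu hg (hψ i) (hψc i) (hψs i) (e i)

/-- The Hardy type inequality obtained by completing the square with the field `k(|x|) x`. -/
theorem HasWeakGradientOn.integral_sq_mul_le {u : 𝔼 → ℝ} {g : 𝔼 → 𝔼}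
    (hw : HasWeakGradientOn {0}ᶜ u g)
    (hu : ∀ K ⊆ ({0}ᶜ : Set 𝔼), IsCompact K → MemLp u 2 (volume.restrict K))
    (hg : ∀ K ⊆ ({0}ᶜ : Set 𝔼), IsCompact K → MemLp g 2 (volume.restrict K))
    {w : ℝ → ℝ} (hwc : ContinuousOn w (Set.Ioi 0)) (hw0 : ∀ r, 0 < r → 0 < w r)
    (hwn : ∀ r, 0 ≤ r → 0 ≤ w r)
    (hgw : Integrable fun x => w ‖x‖ * ‖g x‖ ^ 2)
    {k : ℝ → ℝ} (hk : ContDiff ℝ (⊤ : ℕ∞) k) {δ R : ℝ} (hδ : 0 < δ)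
    (h0 : ∀ r < δ, k r = 0) (h1 : ∀ r, R < r → k r = 0) :
    Integrable (fun x => u x ^ 2 * (N * k ‖x‖ + ‖x‖ * deriv k ‖x‖ - (k ‖x‖ * ‖x‖) ^ 2 / w ‖x‖)) ∧
    ∫ x, u x ^ 2 * (N * k ‖x‖ + ‖x‖ * deriv k ‖x‖ - (k ‖x‖ * ‖x‖) ^ 2 / w ‖x‖) ≤
      ∫ x, w ‖x‖ * ‖g x‖ ^ 2 := by
  obtain ⟨hI1, hI2, hE⟩ := hw.integral_sq_mul_radial hu hg hk hδ h0 h1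
  let F : 𝔼 → ℝ := fun x => (k ‖x‖ * ‖x‖) ^ 2 / w ‖x‖
  have hF0 : ∀ x, ‖x‖ < δ → F x = 0 := fun x hx => by simp [F, h0 _ hx]
  have hF1 : ∀ x, R < ‖x‖ → F x = 0 := fun x hx => by simp [F, h1 _ hx]
  have hFs : tsupport F ⊆ {0}ᶜ := by
    refine (tsupport_subset_of_forall_norm hF0 hF1).trans ?_
    rintro x ⟨hx, -⟩ rfl
    simp at hx; linarith
  have hFc : HasCompactSupport F := hasCompactSupport_of_forall_norm hF1
  have hF : Continuous F := by
    refine continuous_comp_norm_of_continuousOn (F := fun r => (k r * r) ^ 2 / w r) ?_ hδ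
      fun r hr => by simp [h0 r hr]
    exact ((hk.continuous.continuousOn.mul continuousOn_id).pow 2).div hwc fun r hr =>
      (hw0 r hr).ne'
  have hI3 : Integrable fun x => u x ^ 2 * F x :=
    integrable_mul_of_integrableOn_tsupport (hu _ hFs hFc).integrable_sq hF hFc
  have hI : Integrable fun x =>
      u x ^ 2 * (N * k ‖x‖ + ‖x‖ * deriv k ‖x‖ - (k ‖x‖ * ‖x‖) ^ 2 / w ‖x‖) :=
    (hI1.sub hI3).congr (Eventually.of_forall fun x => by simp only [F, Pi.sub_apply]; ring)
  refine ⟨hI, ?_⟩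
  calc ∫ x, u x ^ 2 * (N * k ‖x‖ + ‖x‖ * deriv k ‖x‖ - (k ‖x‖ * ‖x‖) ^ 2 / w ‖x‖)
      = (∫ x, u x ^ 2 * (N * k ‖x‖ + ‖x‖ * deriv k ‖x‖)) - ∫ x, u x ^ 2 * F x := by
        rw [← integral_sub hI1 hI3]
        congr 1; ext x; simp only [F]; ring
    _ = ∫ x, (-2 * (u x * inner ℝ (g x) x * k ‖x‖) - u x ^ 2 * F x) := by
        rw [integral_sub (hI2.const_mul _) hI3, integral_const_mul, hE]; ring
    _ ≤ _ := by
        refine integral_mono ((hI2.const_mul _).sub hI3) hgw fun x => ?_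
        have hc : |inner ℝ (g x) x| ≤ ‖g x‖ * ‖x‖ := abs_real_inner_le_norm _ _
        by_cases hx : x = 0
        · subst hx
          simpa [h0 _ hδ, F] using mul_nonneg (hwn 0 le_rfl) (sq_nonneg ‖g 0‖)
        have hpos : 0 < w ‖x‖ := hw0 _ (norm_pos_iff.2 hx)
        have h2 : -2 * (u x * inner ℝ (g x) x * k ‖x‖) ≤
            2 * ‖g x‖ * |u x * k ‖x‖ * ‖x‖| := by
          have h3 : |u x * inner ℝ (g x) x * k ‖x‖| ≤ ‖g x‖ * |u x * k ‖x‖ * ‖x‖| := by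
            rw [abs_mul, abs_mul, abs_mul, abs_mul, abs_norm]
            calc |u x| * |inner ℝ (g x) x| * |k ‖x‖| ≤ |u x| * (‖g x‖ * ‖x‖) * |k ‖x‖| := by gcongr
              _ = _ := by ring
          have := neg_abs_le (u x * inner ℝ (g x) x * k ‖x‖)
          linarith
        have h4 : u x ^ 2 * F x = |u x * k ‖x‖ * ‖x‖| ^ 2 / w ‖x‖ := by
          simp only [F]; rw [sq_abs]; ring
        rw [h4]
        set B := |u x * k ‖x‖ * ‖x‖|
        -- The completed square: the gap between the two integrands is at least `(w |g| - B)² / w`.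
        have h5 : w ‖x‖ * ‖g x‖ ^ 2 - (2 * ‖g x‖ * B - B ^ 2 / w ‖x‖) =
            (w ‖x‖ * ‖g x‖ - B) ^ 2 / w ‖x‖ := by
          field_simp; ring
        have h6 : 0 ≤ (w ‖x‖ * ‖g x‖ - B) ^ 2 / w ‖x‖ := by positivity
        linarith

end Radial

/-! ### The radial profile and its truncation near the origin. -/

section TestFunctions

open Filter Topology Convolution ContinuousLinearMap

open Real (smoothTransition)

/-- A compactly supported profile `h` with `(2λ - b m r^m) h + r h' - h² ≥ λ² - K r²`. -/
theorem exists_hardy_profile {l b m : ℝ} (hl : 0 < l) (hb : 0 ≤ b) (hm : 0 < m) :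
    ∃ (h : ℝ → ℝ) (K R : ℝ), 0 ≤ K ∧ ContDiffOn ℝ (⊤ : ℕ∞) h (Set.Ioi 0) ∧
      (∀ r, 0 < r → 0 ≤ h r) ∧ (∀ r, R < r → h r = 0) ∧
      ∀ r, 0 < r → l ^ 2 - K * r ^ 2 ≤
        (2 * l - b * m * r ^ m) * h r + r * deriv h r - h r ^ 2 := by
  set a := 1 + b * l with ha
  have ha0 : 0 < a := by positivity
  set D := a * b * m + a ^ 2 with hD
  have hD0 : 0 < D := by positivity
  set R := (m / D) ^ (1 / m) with hR
  have hR0 : 0 < R := by positivity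
  have hRm : ∀ r, 0 < r → r ≤ R → r ^ m * D ≤ m := by
    intro r hr hrR
    have h1 : r ^ m ≤ R ^ m := Real.rpow_le_rpow hr.le hrR hm.le
    have h2 : R ^ m = m / D := by
      rw [hR, ← Real.rpow_mul (by positivity), one_div_mul_cancel hm.ne', Real.rpow_one]
    rw [h2, le_div_iff₀ hD0] at h1
    exact h1
  -- The cutoff is `1` for `r ≤ R / 2` and `0` for `r ≥ R`.
  set h : ℝ → ℝ := fun r => (l + a * r ^ m) * smoothTransition (2 - 2 * r / R) with hh
  have hcd : ContDiffOn ℝ (⊤ : ℕ∞) h (Set.Ioi 0) := by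
    intro r hr
    have h1 : ContDiffAt ℝ (⊤ : ℕ∞) (fun r : ℝ => r ^ m) r :=
      Real.contDiffAt_rpow_const_of_ne (ne_of_gt hr)
    have h2 : ContDiff ℝ (⊤ : ℕ∞) fun r : ℝ => smoothTransition (2 - 2 * r / R) :=
      Real.smoothTransition.contDiff.comp
        (contDiff_const.sub ((contDiff_const.mul contDiff_id).div_const R))
    exact ((contDiffAt_const.add (contDiffAt_const.mul h1)).mul h2.contDiffAt).contDiffWithinAt
  have hz : ∀ r, R < r → h r = 0 := by
    intro r hr
    have : smoothTransition (2 - 2 * r / R) = 0 := by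
      apply Real.smoothTransition.zero_of_nonpos
      have : 1 < r / R := (one_lt_div hR0).2 hr
      rw [mul_div_assoc]; linarith
    simp [hh, this]
  have hcont : ContinuousOn
      (fun r => (2 * l - b * m * r ^ m) * h r + r * deriv h r - h r ^ 2) (Set.Ioi 0) := by
    have h1 : ContinuousOn (fun r : ℝ => r ^ m) (Set.Ioi 0) := fun r hr =>
      (Real.continuousAt_rpow_const r m (Or.inl (ne_of_gt hr))).continuousWithinAt
    have h2 := hcd.continuousOn_deriv_of_isOpen isOpen_Ioi (by simp)
    have h3 := hcd.continuousOn
    exact (((continuousOn_const.sub (continuousOn_const.mul h1)).mul h3).add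
      (continuousOn_id.mul h2)).sub (h3.pow 2)
  obtain ⟨M, hM⟩ := (isCompact_Icc (a := R / 2) (b := R)).exists_bound_of_continuousOn
    (hcont.mono fun r hr => lt_of_lt_of_le (half_pos hR0) hr.1)
  have hM0 : 0 ≤ M := (norm_nonneg _).trans (hM R ⟨by linarith, le_rfl⟩)
  -- Away from the origin a multiple of `r²` dominates any constant, here `l²` plus the bound `M` on
  -- the transition region.
  have hK : ∀ r, R / 2 ≤ r → l ^ 2 + M ≤ (l ^ 2 + M) * 4 / R ^ 2 * r ^ 2 := by
    intro r hr
    have h1 : R ^ 2 ≤ 4 * r ^ 2 := by nlinarith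
    have h2 : (l ^ 2 + M) * 4 / R ^ 2 * r ^ 2 = (l ^ 2 + M) * (4 * r ^ 2 / R ^ 2) := by ring
    rw [h2]
    exact le_mul_of_one_le_right (by positivity) ((one_le_div (by positivity)).2 h1)
  refine ⟨h, (l ^ 2 + M) * 4 / R ^ 2, R, by positivity, hcd, fun r hr => ?_, hz, fun r hr => ?_⟩
  · have := Real.smoothTransition.nonneg (2 - 2 * r / R)
    positivity
  · rcases lt_or_ge r (R / 2) with h1 | h1
    · have hev : h =ᶠ[𝓝 r] fun r => l + a * r ^ m := by
        filter_upwards [Iio_mem_nhds h1] with s hs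
        have : smoothTransition (2 - 2 * s / R) = 1 := by
          apply Real.smoothTransition.one_of_one_le
          have : s / R ≤ 1 / 2 := by
            rw [div_le_iff₀ hR0]; simp only [Set.mem_Iio] at hs; linarith
          rw [mul_div_assoc]; linarith
        simp [hh, this]
      have hd : deriv h r = a * (m * r ^ (m - 1)) := by
        rw [hev.deriv_eq]
        exact (((Real.hasDerivAt_rpow_const (Or.inl hr.ne')).const_mul a).const_add l).deriv
      have hr1 : r * r ^ (m - 1) = r ^ m := by
        rw [mul_comm, Real.rpow_sub_one hr.ne', div_mul_cancel₀ _ hr.ne']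
      rw [hd, hev.eq_of_nhds]
      have h2 := hRm r hr (by linarith)
      have h3 : 0 ≤ r ^ m := by positivity
      have h4 : r * (a * (m * r ^ (m - 1))) = a * m * r ^ m := by rw [← hr1]; ring
      rw [h4]
      have h5 : (2 * l - b * m * r ^ m) * (l + a * r ^ m) + a * m * r ^ m - (l + a * r ^ m) ^ 2 =
          l ^ 2 + r ^ m * (m - r ^ m * D) := by rw [hD, ha]; ring
      rw [h5]
      have h6 : 0 ≤ r ^ m * (m - r ^ m * D) := mul_nonneg h3 (by linarith)
      have h7 : 0 ≤ (l ^ 2 + M) * 4 / R ^ 2 * r ^ 2 := by positivity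
      linarith
    · have h2 := hK r h1
      rcases le_or_gt r R with h3 | h3
      · have := hM r ⟨h1, h3⟩
        rw [Real.norm_eq_abs] at this
        have := neg_le_of_abs_le this
        linarith
      · have hev : h =ᶠ[𝓝 r] fun _ => 0 := by
          filter_upwards [Ioi_mem_nhds h3] with s hs using hz s hs
        rw [hev.deriv_eq, hev.eq_of_nhds]
        simp
        linarith

/-- The radial weight. -/
noncomputable def radialWeight (β b m r : ℝ) : ℝ := r ^ (-β) * Real.exp (-b * r ^ m)

theorem radialWeight_pos (β b m : ℝ) {r : ℝ} (hr : 0 < r) : 0 < radialWeight β b m r := by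
  unfold radialWeight; positivity

theorem radialWeight_nonneg (β b m : ℝ) {r : ℝ} (hr : 0 ≤ r) : 0 ≤ radialWeight β b m r := by
  unfold radialWeight; positivity

theorem contDiffAt_radialWeight (β b m : ℝ) {r : ℝ} (hr : 0 < r) :
    ContDiffAt ℝ (⊤ : ℕ∞) (radialWeight β b m) r :=
  (Real.contDiffAt_rpow_const_of_ne hr.ne').mul
    (contDiffAt_const.mul (Real.contDiffAt_rpow_const_of_ne hr.ne')).exp

theorem hasDerivAt_radialWeight (β b m : ℝ) {r : ℝ} (hr : 0 < r) :
    HasDerivAt (radialWeight β b m) (radialWeight β b m r * (-β - b * m * r ^ m) / r) r := by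
  have h1 : HasDerivAt (fun r : ℝ => r ^ (-β)) (-β * r ^ (-β - 1)) r :=
    Real.hasDerivAt_rpow_const (Or.inl hr.ne')
  have h2 : HasDerivAt (fun r : ℝ => r ^ m) (m * r ^ (m - 1)) r :=
    Real.hasDerivAt_rpow_const (Or.inl hr.ne')
  convert! h1.mul (h2.const_mul (-b)).exp using 1
  rw [Real.rpow_sub_one hr.ne', Real.rpow_sub_one hr.ne', radialWeight]
  field_simp
  ring

/-- The test field obtained from a profile `h` by truncation near the origin. -/
theorem exists_hardy_test {n l β b m K R ε : ℝ} (hn : n - β - 2 = 2 * l) {h : ℝ → ℝ}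
    (hε : 0 < ε) (hcd : ContDiffOn ℝ (⊤ : ℕ∞) h (Set.Ioi 0)) (hnn : ∀ r, 0 < r → 0 ≤ h r)
    (hz : ∀ r, R < r → h r = 0)
    (hB : ∀ r, 0 < r → l ^ 2 - K * r ^ 2 ≤
        (2 * l - b * m * r ^ m) * h r + r * deriv h r - h r ^ 2) :
    ∃ k : ℝ → ℝ, ContDiff ℝ (⊤ : ℕ∞) k ∧ (∀ r < ε, k r = 0) ∧ (∀ r, R < r → k r = 0) ∧
      ∀ r, 0 < r → radialWeight β b m r / r ^ 2 * smoothTransition (r / ε - 1) *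
        (l ^ 2 - K * r ^ 2) ≤ n * k r + r * deriv k r - (k r * r) ^ 2 / radialWeight β b m r := by
  set w := radialWeight β b m with hw
  set χ : ℝ → ℝ := fun r => smoothTransition (r / ε - 1) with hχ
  have hχ0 : ∀ r < ε, χ r = 0 := fun r hr => Real.smoothTransition.zero_of_nonpos (by
    have := (div_lt_one hε).2 hr
    linarith)
  have hχs : ContDiff ℝ (⊤ : ℕ∞) χ :=
    Real.smoothTransition.contDiff.comp ((contDiff_id.div_const ε).sub contDiff_const)
  have hχm : Monotone χ := fun r s hrs => Real.smoothTransition.monotone (by gcongr)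
  -- The factor `w / r²` turns the divergence expression for `k` into the profile expression for `h
  -- χ`.
  refine ⟨fun r => w r / r ^ 2 * (h r * χ r), ?_, ?_, ?_, ?_⟩
  · rw [contDiff_iff_contDiffAt]
    intro r
    rcases lt_or_ge r ε with h1 | h1
    · have : (fun r => w r / r ^ 2 * (h r * χ r)) =ᶠ[𝓝 r] fun _ => 0 := by
        filter_upwards [Iio_mem_nhds h1] with s hs
        simp [hχ0 s hs]
      exact contDiffAt_const.congr_of_eventuallyEq this
    · have hr : 0 < r := hε.trans_le h1
      exact ((contDiffAt_radialWeight β b m hr).div (contDiffAt_id.pow 2)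
        (by simp; exact hr.ne')).mul
        ((hcd.contDiffAt (Ioi_mem_nhds hr)).mul hχs.contDiffAt)
  · intro r hr
    simp [hχ0 r hr]
  · intro r hr
    simp [hz r hr]
  · intro r hr
    have hwr : 0 < w r := radialWeight_pos β b m hr
    have d1 := (hasDerivAt_radialWeight β b m hr).div (hasDerivAt_pow 2 r)
      (by positivity : r ^ 2 ≠ 0)
    have d2 : HasDerivAt h (deriv h r) r :=
      ((hcd.contDiffAt (Ioi_mem_nhds hr)).differentiableAt (by simp)).hasDerivAt
    have d3 : HasDerivAt χ (deriv χ r) r := (hχs.differentiable (by simp) r).hasDerivAt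
    have d := (d1.mul (d2.mul d3)).deriv
    have e : deriv (fun r => w r / r ^ 2 * (h r * χ r)) r = _ := d
    rw [e]
    have hχ' : 0 ≤ deriv χ r := hχm.deriv_nonneg
    have hχn : 0 ≤ χ r := Real.smoothTransition.nonneg _
    have hχ1 : χ r ≤ 1 := Real.smoothTransition.le_one _
    have hh := hnn r hr
    have e1 : n * (w r / r ^ 2 * (h r * χ r)) + r *
        ((w r * (-β - b * m * r ^ m) / r * r ^ 2 - w r * (((2 : ℕ) : ℝ) * r ^ (2 - 1))) /
          (r ^ 2) ^ 2 * (h r * χ r) + w r / r ^ 2 * (deriv h r * χ r + h r * deriv χ r)) -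
        (w r / r ^ 2 * (h r * χ r) * r) ^ 2 / w r =
        w r / r ^ 2 * ((n - β - 2 - b * m * r ^ m) * (h r * χ r) +
          r * (deriv h r * χ r + h r * deriv χ r) - h r ^ 2 * χ r ^ 2) := by
      simp only [Nat.cast_ofNat, Nat.add_one_sub_one, pow_one]
      field_simp
      ring
    refine le_trans ?_ e1.symm.le
    rw [hn, mul_assoc]
    refine mul_le_mul_of_nonneg_left ?_ (by positivity)
    calc χ r * (l ^ 2 - K * r ^ 2)
        ≤ χ r * ((2 * l - b * m * r ^ m) * h r + r * deriv h r - h r ^ 2) :=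
          mul_le_mul_of_nonneg_left (hB r hr) hχn
      _ = (2 * l - b * m * r ^ m) * (h r * χ r) + r * (deriv h r * χ r) - h r ^ 2 * χ r := by ring
      _ ≤ _ := by
          -- Truncation has a favourable sign: `χ` is nondecreasing and `h ≥ 0`, while `χ² ≤ χ`
          -- shrinks the subtracted square.
          have i1 : 0 ≤ r * (h r * deriv χ r) := by positivity
          have i2 : χ r ^ 2 ≤ χ r := by nlinarith
          have i3 : h r ^ 2 * χ r ^ 2 ≤ h r ^ 2 * χ r :=
            mul_le_mul_of_nonneg_left i2 (sq_nonneg _)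
          linarith

end TestFunctions

/-! ### The Hardy inequality on the weighted Sobolev space. -/

section Inequality

open Filter Topology Convolution ContinuousLinearMap

/-- Fatou's lemma for integrable functions with bounded integrals. -/
theorem integrable_and_integral_le_of_tendsto {α : Type*} [MeasurableSpace α] {μ : Measure α}
    {f : ℕ → α → ℝ} {F : α → ℝ} {M : ℝ} (hf : ∀ n, Integrable (f n) μ) (h0 : ∀ n x, 0 ≤ f n x)
    (hM : ∀ n, ∫ x, f n x ∂μ ≤ M) (hF : ∀ x, Tendsto (fun n => f n x) atTop (𝓝 (F x))) :
    Integrable F μ ∧ ∫ x, F x ∂μ ≤ M := by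
  have hM0 : 0 ≤ M := (integral_nonneg (h0 0)).trans (hM 0)
  have hFm : AEStronglyMeasurable F μ :=
    aestronglyMeasurable_of_tendsto_ae atTop (fun n => (hf n).1) (Eventually.of_forall hF)
  have hF0 : ∀ x, 0 ≤ F x := fun x => ge_of_tendsto' (hF x) fun n => h0 n x
  have h1 : ∫⁻ x, ENNReal.ofReal (F x) ∂μ ≤ ENNReal.ofReal M := by
    calc ∫⁻ x, ENNReal.ofReal (F x) ∂μ
        = ∫⁻ x, liminf (fun n => ENNReal.ofReal (f n x)) atTop ∂μ := by
          congr 1; ext x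
          exact ((ENNReal.tendsto_ofReal (hF x)).liminf_eq).symm
      _ ≤ liminf (fun n => ∫⁻ x, ENNReal.ofReal (f n x) ∂μ) atTop :=
          lintegral_liminf_le' fun n => (hf n).1.aemeasurable.ennreal_ofReal
      _ ≤ ENNReal.ofReal M := by
          refine liminf_le_of_le (by isBoundedDefault) fun c hc => ?_
          obtain ⟨n, hn⟩ := hc.exists
          refine hn.trans ?_
          rw [← ofReal_integral_eq_lintegral_ofReal (hf n) (Eventually.of_forall (h0 n))]
          exact ENNReal.ofReal_le_ofReal (hM n)
  refine ⟨⟨hFm, ?_⟩, ?_⟩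
  · rw [hasFiniteIntegral_iff_ofReal (Eventually.of_forall hF0)]
    exact h1.trans_lt ENNReal.ofReal_lt_top
  · rw [integral_eq_lintegral_of_nonneg_ae (Eventually.of_forall hF0) hFm]
    exact ENNReal.toReal_le_of_le_ofReal hM0 h1

variable {N : ℕ}

local notation "𝔼" => EuclideanSpace ℝ (Fin N)

theorem measurable_radialWeight_norm (β b m : ℝ) :
    Measurable fun x : 𝔼 => radialWeight β b m ‖x‖ := by
  unfold radialWeight
  fun_prop

theorem weightMeasure_eq (β b m : ℝ) : weightMeasure N β b m =
    volume.withDensity fun x => ENNReal.ofReal (radialWeight β b m ‖x‖) := rfl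

theorem integral_weightMeasure (β b m : ℝ) (f : 𝔼 → ℝ) :
    ∫ x, f x ∂(weightMeasure N β b m) = ∫ x, radialWeight β b m ‖x‖ * f x := by
  rw [weightMeasure_eq, integral_withDensity_eq_integral_toReal_smul
    (measurable_radialWeight_norm β b m).ennreal_ofReal (by simp)]
  simp [ENNReal.toReal_ofReal (radialWeight_nonneg β b m (norm_nonneg _))]

theorem integrable_weightMeasure_iff (β b m : ℝ) (f : 𝔼 → ℝ) :
    Integrable f (weightMeasure N β b m) ↔ Integrable fun x => radialWeight β b m ‖x‖ * f x := by
  rw [weightMeasure_eq, integrable_withDensity_iff_integrable_smul'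
    (measurable_radialWeight_norm β b m).ennreal_ofReal (by simp)]
  simp [ENNReal.toReal_ofReal (radialWeight_nonneg β b m (norm_nonneg _))]

/-- On a compact set avoiding the origin the weight is bounded below, so Lebesgue measure there is
at most a multiple of `μ`. -/
theorem memLp_restrict_of_memLp_weightMeasure {F : Type*} [NormedAddCommGroup F] {β b m : ℝ}
    {p : ENNReal} {f : 𝔼 → F} (hf : MemLp f p (weightMeasure N β b m)) {K : Set 𝔼}
    (hK0 : K ⊆ {0}ᶜ) (hK : IsCompact K) : MemLp f p (volume.restrict K) := by
  have hc : ContinuousOn (fun x : 𝔼 => (radialWeight β b m ‖x‖)⁻¹) K := by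
    intro x hx
    have hx0 : 0 < ‖x‖ := norm_pos_iff.2 (hK0 hx)
    exact (((contDiffAt_radialWeight β b m hx0).continuousAt.comp
      continuous_norm.continuousAt).inv₀ (radialWeight_pos β b m hx0).ne').continuousWithinAt
  obtain ⟨C, hC⟩ := hK.exists_bound_of_continuousOn hc
  refine hf.of_measure_le_smul (c := ENNReal.ofReal C) ENNReal.ofReal_ne_top ?_
  have hm := (measurable_radialWeight_norm (N := N) β b m).ennreal_ofReal
  refine Measure.le_iff.2 fun s hs => ?_
  rw [Measure.restrict_apply hs, Measure.smul_apply, smul_eq_mul]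
  have hsK : MeasurableSet (s ∩ K) := hs.inter hK.measurableSet
  calc volume (s ∩ K) = ∫⁻ _ in s ∩ K, 1 := by simp
    _ ≤ ∫⁻ x in s ∩ K, ENNReal.ofReal C * ENNReal.ofReal (radialWeight β b m ‖x‖) := by
        refine setLIntegral_mono (hm.const_mul _) fun x hx => ?_
        have hx0 : 0 < ‖x‖ := norm_pos_iff.2 (hK0 hx.2)
        have hw := radialWeight_pos β b m hx0
        have h1 := hC x hx.2
        rw [Real.norm_eq_abs, abs_of_pos (inv_pos.2 hw)] at h1
        rw [← ENNReal.ofReal_mul' hw.le, ← ENNReal.ofReal_one]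
        refine ENNReal.ofReal_le_ofReal ?_
        rwa [inv_le_iff_one_le_mul₀ hw] at h1
    _ = ENNReal.ofReal C * weightMeasure N β b m (s ∩ K) := by
        rw [lintegral_const_mul _ hm, weightMeasure_eq, withDensity_apply _ hsK]
    _ ≤ _ := by gcongr; exact Set.inter_subset_left

theorem weighted_hardy_inequality {β b m : ℝ} (hβ : β < (N : ℝ) - 2)
    (hb : 0 ≤ b) (hm : 0 < m) :
    ∃ C : ℝ, 0 ≤ C ∧
      ∀ (u : EuclideanSpace ℝ (Fin N) → ℝ)
        (g : EuclideanSpace ℝ (Fin N) → EuclideanSpace ℝ (Fin N)),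
        MemWeightedH1 (weightMeasure N β b m) u g →
          Integrable (fun x => u x ^ 2 / ‖x‖ ^ 2) (weightMeasure N β b m) ∧
          hardyConst (N - β) * ∫ x, u x ^ 2 / ‖x‖ ^ 2 ∂(weightMeasure N β b m) ≤
            ∫ x, ‖g x‖ ^ 2 ∂(weightMeasure N β b m) +
              C * ∫ x, u x ^ 2 ∂(weightMeasure N β b m) := by
  set l : ℝ := ((N : ℝ) - β - 2) / 2 with hl
  have hl0 : 0 < l := by rw [hl]; linarith
  obtain ⟨h, K, R, hK, hcd, hnn, hz, hB⟩ := exists_hardy_profile hl0 hb hm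
  refine ⟨K, hK, fun u g H => ?_⟩
  have hwn : ∀ r, 0 ≤ r → 0 ≤ radialWeight β b m r := fun r => radialWeight_nonneg β b m
  have hgw : Integrable fun x => radialWeight β b m ‖x‖ * ‖g x‖ ^ 2 :=
    (integrable_weightMeasure_iff β b m _).1 H.memLp_grad.norm.integrable_sq
  have huw : Integrable fun x => radialWeight β b m ‖x‖ * u x ^ 2 :=
    (integrable_weightMeasure_iff β b m _).1 H.memLp.integrable_sq
  let ε : ℕ → ℝ := fun n => 1 / ((n : ℝ) + 1)
  have hε : ∀ n, 0 < ε n := fun n => by positivity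
  have hεt : Tendsto ε atTop (𝓝 0) := tendsto_one_div_add_atTop_nhds_zero_nat
  let χ : ℕ → 𝔼 → ℝ := fun n x => Real.smoothTransition (‖x‖ / ε n - 1)
  have hχ0 : ∀ n x, 0 ≤ χ n x := fun n x => Real.smoothTransition.nonneg _
  have hχ1 : ∀ n x, χ n x ≤ 1 := fun n x => Real.smoothTransition.le_one _
  have hχc : ∀ n, Continuous (χ n) := fun n =>
    Real.smoothTransition.continuous.comp ((continuous_norm.div_const _).sub continuous_const)
  have hχz : ∀ n x, ‖x‖ < ε n → χ n x = 0 := fun n x hx =>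
    Real.smoothTransition.zero_of_nonpos (by
      have := (div_lt_one (hε n)).2 hx
      linarith)
  let f : ℕ → 𝔼 → ℝ := fun n x => radialWeight β b m ‖x‖ * u x ^ 2 * (χ n x / ‖x‖ ^ 2)
  have hf0 : ∀ n x, 0 ≤ f n x := fun n x => by
    have := hwn ‖x‖ (norm_nonneg _)
    have := hχ0 n x
    positivity
  have hfI : ∀ n, Integrable (f n) := by
    intro n
    refine huw.mul_bdd (c := 1 / ε n ^ 2) ?_ (Eventually.of_forall fun x => ?_)
    · exact ((hχc n).measurable.div (measurable_norm.pow_const 2)).aestronglyMeasurable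
    · have := hχ0 n x
      rw [Real.norm_of_nonneg (by positivity)]
      rcases lt_or_ge ‖x‖ (ε n) with h1 | h1
      · rw [hχz n x h1, zero_div]
        have := hε n
        positivity
      · have h2 := hε n
        have h3 := hχ1 n x
        gcongr
  have hI2 : ∀ n, Integrable fun x => radialWeight β b m ‖x‖ * u x ^ 2 * χ n x := fun n =>
    huw.mul_bdd (c := 1) (hχc n).aestronglyMeasurable (Eventually.of_forall fun x => by
      rw [Real.norm_of_nonneg (hχ0 n x)]; exact hχ1 n x)
  -- The constant `K` comes from the profile alone, so the bound is uniform in the truncation radius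
  -- `ε n`.
  have hbound : ∀ n, l ^ 2 * ∫ x, f n x ≤
      (∫ x, radialWeight β b m ‖x‖ * ‖g x‖ ^ 2) + K * ∫ x, radialWeight β b m ‖x‖ * u x ^ 2 := by
    intro n
    obtain ⟨k, hk, hk0, hk1, hkB⟩ := exists_hardy_test (n := N) (β := β) (b := b) (m := m)
      (by rw [hl]; ring) (hε n) hcd hnn hz hB
    obtain ⟨hI, hle⟩ := H.hasWeakGradientOn.integral_sq_mul_le
      (fun K hK0 hK => memLp_restrict_of_memLp_weightMeasure H.memLp hK0 hK)
      (fun K hK0 hK => memLp_restrict_of_memLp_weightMeasure H.memLp_grad hK0 hK)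
      (fun r hr => (contDiffAt_radialWeight β b m hr).continuousAt.continuousWithinAt)
      (fun r => radialWeight_pos β b m) hwn hgw hk (hε n) hk0 hk1
    have h1 : ∫ x, (l ^ 2 * f n x - K * (radialWeight β b m ‖x‖ * u x ^ 2 * χ n x)) ≤
        ∫ x, radialWeight β b m ‖x‖ * ‖g x‖ ^ 2 := by
      refine le_trans (integral_mono (((hfI n).const_mul _).sub ((hI2 n).const_mul _)) hI
        fun x => ?_) hle
      by_cases hx : x = 0
      · subst hx
        simp [f, hk0 0 (hε n), hχz n 0 (by simpa using hε n)]
      · have hx0 : 0 < ‖x‖ := norm_pos_iff.2 hx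
        have := mul_le_mul_of_nonneg_left (hkB ‖x‖ hx0) (sq_nonneg (u x))
        refine le_trans (le_of_eq ?_) this
        simp only [f, χ]
        field_simp
    rw [integral_sub ((hfI n).const_mul _) ((hI2 n).const_mul _), integral_const_mul,
      integral_const_mul] at h1
    have h2 : ∫ x, radialWeight β b m ‖x‖ * u x ^ 2 * χ n x ≤
        ∫ x, radialWeight β b m ‖x‖ * u x ^ 2 :=
      integral_mono (hI2 n) huw fun x => mul_le_of_le_one_right
        (mul_nonneg (hwn _ (norm_nonneg _)) (sq_nonneg _)) (hχ1 n x)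
    have h3 := mul_le_mul_of_nonneg_left h2 hK
    linarith
  have hlim : ∀ x, Tendsto (fun n => f n x) atTop
      (𝓝 (radialWeight β b m ‖x‖ * (u x ^ 2 / ‖x‖ ^ 2))) := by
    intro x
    refine tendsto_const_nhds.congr' ?_
    by_cases hx : x = 0
    · subst hx
      -- At the origin both sides are `0`, because division by zero gives zero.
      exact Eventually.of_forall fun n => by simp [f]
    · have hx0 : 0 < ‖x‖ := norm_pos_iff.2 hx
      filter_upwards [hεt.eventually_lt_const (half_pos hx0)] with n hn
      have : χ n x = 1 := by
        apply Real.smoothTransition.one_of_one_le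
        have : 2 ≤ ‖x‖ / ε n := by rw [le_div_iff₀ (hε n)]; linarith
        linarith
      simp only [f, this]
      ring
  -- Fatou yields integrability of `u² / |x|²` together with the estimate; dividing by `l²` uses `l
  -- > 0`.
  obtain ⟨hint, hle⟩ := integrable_and_integral_le_of_tendsto hfI hf0
    (fun n => (le_div_iff₀' (by positivity : 0 < l ^ 2)).2 (hbound n)) hlim
  refine ⟨(integrable_weightMeasure_iff β b m _).2 hint, ?_⟩
  have hc : hardyConst (N - β) = l ^ 2 := rfl
  rw [hc, integral_weightMeasure, integral_weightMeasure, integral_weightMeasure]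
  exact (le_div_iff₀' (by positivity : 0 < l ^ 2)).1 hle

end Inequality

/-! ### Optimality of the constant in logarithmic coordinates. -/

section Optimality

open Filter Topology Convolution ContinuousLinearMap

variable {N : ℕ}

local notation "𝔼" => EuclideanSpace ℝ (Fin N)

/-- Integration of radial functions in logarithmic polar coordinates. -/
theorem integral_comp_norm_eq_integral_exp [NeZero N] (F : ℝ → ℝ) :
    ∫ x : 𝔼, F ‖x‖ = (N * volume.real (Metric.ball (0 : 𝔼) 1)) *
      ∫ t, Real.exp (N * t) * F (Real.exp t) := by
  rw [integral_fun_norm_addHaar]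
  have h := integral_image_eq_integral_abs_deriv_smul (s := Set.univ) (f := Real.exp)
    (f' := Real.exp) MeasurableSet.univ (fun x _ => (Real.hasDerivAt_exp x).hasDerivWithinAt)
    Real.exp_injective.injOn (fun y => y ^ (N - 1) • F y)
  rw [Set.image_univ, Real.range_exp, setIntegral_univ] at h
  simp only [finrank_euclideanSpace, Fintype.card_fin]
  rw [h]
  simp only [nsmul_eq_mul, smul_eq_mul, mul_assoc]
  congr 3
  ext t
  rw [abs_of_pos (Real.exp_pos t), ← mul_assoc, ← pow_succ', Nat.sub_add_cancel NeZero.one_le,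
    ← Real.exp_nat_mul]

theorem integral_weightMeasure_radial [NeZero N] (β b m : ℝ) (G : ℝ → ℝ) :
    ∫ x : 𝔼, G ‖x‖ ∂(weightMeasure N β b m) = (N * volume.real (Metric.ball (0 : 𝔼) 1)) *
      ∫ t, Real.exp (-b * Real.exp (m * t)) * (Real.exp ((N - β) * t) * G (Real.exp t)) := by
  rw [integral_weightMeasure,
    integral_comp_norm_eq_integral_exp (fun r => radialWeight β b m r * G r)]
  congr 2
  ext t
  rw [radialWeight, ← Real.exp_mul, ← Real.exp_mul, mul_comm t m,
    show ((N : ℝ) - β) * t = N * t + t * -β by ring, Real.exp_add]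
  ring

/-- With `a = k'(|x|)` this is the squared length of the radial gradient. The hypothesis covers the
origin, where the left side is `0`. -/
theorem norm_div_norm_smul_sq {x : 𝔼} {a : ℝ} (h : x = 0 → a = 0) :
    ‖(a / ‖x‖) • x‖ ^ 2 = a ^ 2 := by
  by_cases hx : x = 0
  · simp [h hx]
  · rw [norm_smul, norm_div, norm_norm, div_mul_cancel₀ _ (norm_ne_zero_iff.2 hx),
      Real.norm_eq_abs, sq_abs]

/-- A smooth radial function vanishing near the origin, with its classical gradient, belongs to the
weighted Sobolev space. -/
theorem memWeightedH1_radial (β b m : ℝ) {k : ℝ → ℝ} (hk : ContDiff ℝ (⊤ : ℕ∞) k) {δ R : ℝ}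
    (hδ : 0 < δ) (h0 : ∀ r < δ, k r = 0) (h1 : ∀ r, R < r → k r = 0) :
    MemWeightedH1 (weightMeasure N β b m) (fun x => k ‖x‖)
      (fun x => (deriv k ‖x‖ / ‖x‖) • x) := by
  have hd0 : ∀ r < δ, deriv k r = 0 := fun r hr => by
    have : k =ᶠ[𝓝 r] fun _ => 0 := by
      filter_upwards [Iio_mem_nhds hr] with s hs using h0 s hs
    rw [this.deriv_eq]; simp
  have hd1 : ∀ r, R < r → deriv k r = 0 := fun r hr => by
    have : k =ᶠ[𝓝 r] fun _ => 0 := by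
      filter_upwards [Ioi_mem_nhds hr] with s hs using h1 s hs
    rw [this.deriv_eq]; simp
  have hdc : Continuous (deriv k) := hk.continuous_deriv (by simp)
  have huc : ContDiff ℝ (⊤ : ℕ∞) fun x : 𝔼 => k ‖x‖ := contDiff_comp_norm hk hδ h0
  have hgc : Continuous fun x : 𝔼 => (deriv k ‖x‖ / ‖x‖) • x := by
    refine (continuous_comp_norm_of_continuousOn (F := fun r => deriv k r / r) ?_ hδ
      fun r hr => by simp [hd0 r hr]).smul continuous_id
    exact hdc.continuousOn.div continuousOn_id fun r hr => ne_of_gt hr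
  have hgn : ∀ x : 𝔼, ‖(deriv k ‖x‖ / ‖x‖) • x‖ ^ 2 = deriv k ‖x‖ ^ 2 := fun x =>
    norm_div_norm_smul_sq fun h => by simp [h, hd0 0 hδ]
  have hInt : ∀ q : ℝ → ℝ, Continuous q → (∀ r < δ, q r = 0) → (∀ r, R < r → q r = 0) →
      Integrable (fun x : 𝔼 => q ‖x‖ ^ 2) (weightMeasure N β b m) := by
    intro q hq hq0 hq1
    rw [integrable_weightMeasure_iff]
    refine Continuous.integrable_of_hasCompactSupport ?_
      (hasCompactSupport_of_forall_norm (R := R) fun x hx => by simp [hq1 _ hx])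
    refine continuous_comp_norm_of_continuousOn (F := fun r => radialWeight β b m r * q r ^ 2) ?_ hδ
      fun r hr => by simp [hq0 r hr]
    exact ContinuousOn.mul (fun r hr =>
      (contDiffAt_radialWeight β b m hr).continuousAt.continuousWithinAt)
      (hq.pow 2).continuousOn
  refine ⟨?_, ?_, ⟨?_, ?_, ?_⟩⟩
  · exact (memLp_two_iff_integrable_sq huc.continuous.aestronglyMeasurable).2
      (hInt k hk.continuous h0 h1)
  · refine (memLp_two_iff_integrable_sq_norm hgc.aestronglyMeasurable).2 ?_
    simp_rw [hgn]
    exact hInt _ hdc hd0 hd1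
  · exact huc.continuous.locallyIntegrable.locallyIntegrableOn _
  · exact hgc.locallyIntegrable.locallyIntegrableOn _
  · intro φ hφ hφc _ v
    have hfd : ∀ x : 𝔼, inner ℝ ((deriv k ‖x‖ / ‖x‖) • x) v = fderiv ℝ (fun x : 𝔼 => k ‖x‖) x v :=
      fun x => by
        rw [fderiv_comp_norm (hk.differentiable (by simp)) hδ h0, real_inner_smul_left]
    simp_rw [hfd]
    have hfc : Continuous fun x => fderiv ℝ φ x v :=
      (hφ.continuous_fderiv (by simp)).clm_apply continuous_const
    have huf : Continuous fun x => fderiv ℝ (fun x : 𝔼 => k ‖x‖) x v :=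
      (huc.continuous_fderiv (by simp)).clm_apply continuous_const
    exact integral_mul_fderiv_eq_neg_fderiv_mul_of_integrable
      ((huf.mul hφ.continuous).integrable_of_hasCompactSupport hφc.mul_left)
      ((huc.continuous.mul hfc).integrable_of_hasCompactSupport (hφc.fderiv_apply ℝ v).mul_left)
      ((huc.continuous.mul hφ.continuous).integrable_of_hasCompactSupport hφc.mul_left)
      (fun x _ => (huc.differentiable (by simp)).differentiableAt)
      (fun x _ => (hφ.differentiable (by simp)).differentiableAt)

/-- One dimensional test functions for the optimality of the Hardy constant, in logarithmic
coordinates. -/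
theorem exists_log_profile {l c : ℝ} (hl : 0 < l) (hc : l ^ 2 < c) (C : ℝ) {b m : ℝ} (hb : 0 ≤ b)
    (hm : 0 < m) :
    ∃ (φ : ℝ → ℝ) (L : ℝ), 0 < L ∧ ContDiff ℝ (⊤ : ℕ∞) φ ∧
      (∀ t < -2 * L, φ t = 0) ∧ (∀ t, -L < t → φ t = 0) ∧
      (∫ t, Real.exp (-b * Real.exp (m * t)) * (deriv φ t - l * φ t) ^ 2) +
        C * ∫ t, Real.exp (-b * Real.exp (m * t)) * (Real.exp (2 * t) * φ t ^ 2) <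
      c * ∫ t, Real.exp (-b * Real.exp (m * t)) * φ t ^ 2 := by
  -- The support is `[-2, -1]`, which stretches to `[-2L, -L]`.
  let Φ : ContDiffBump (-(3 / 2) : ℝ) := ⟨1 / 4, 1 / 2, by norm_num, by norm_num⟩
  have hΦs : ContDiff ℝ (⊤ : ℕ∞) Φ := Φ.contDiff
  have hΦ0 : ∀ t, t ∉ Set.Icc (-2 : ℝ) (-1) → Φ t = 0 ∧ deriv Φ t = 0 := by
    intro t ht
    have : t ∉ tsupport Φ := by
      rw [Φ.tsupport_eq, Real.closedBall_eq_Icc]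
      change t ∉ Set.Icc (-(3 / 2) - 1 / 2 : ℝ) (-(3 / 2) + 1 / 2)
      norm_num at ht ⊢
      exact ht
    exact ⟨image_eq_zero_of_notMem_tsupport this,
      image_eq_zero_of_notMem_tsupport fun h => this (tsupport_deriv_subset h)⟩
  have hΦ'c : Continuous (deriv Φ) := hΦs.continuous_deriv (by simp)
  set P := ∫ t, deriv Φ t ^ 2 with hP
  set Q := ∫ t, Φ t ^ 2 with hQ
  have hP0 : 0 ≤ P := integral_nonneg fun t => sq_nonneg _
  have hQ0 : 0 < Q := by
    have hcs : HasCompactSupport fun t => Φ t ^ 2 :=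
      HasCompactSupport.intro (isCompact_Icc (a := (-2 : ℝ)) (b := -1)) fun t ht => by
        simp [(hΦ0 t ht).1]
    refine (hΦs.continuous.pow 2).integral_pos_of_hasCompactSupport_nonneg_nonzero hcs
      (fun t => sq_nonneg _) (x := -(3 / 2)) ?_
    rw [Φ.one_of_mem_closedBall (Metric.mem_closedBall_self Φ.rIn_pos.le)]
    norm_num
  set η := c - l ^ 2 with hη
  have hη0 : 0 < η := by rw [hη]; linarith
  -- This is the constant in Young's inequality `(p - l q)² ≤ A p² + (l² + η/4) q²`. Of the surplus
  -- `η = c - l²`, one quarter pays for the cross term and one quarter for the `C` term.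
  set A := 1 + 4 * l ^ 2 / η with hA
  have hA0 : 0 < A := by positivity
  -- Stretching gives `∫ φ'² = P / L` and `∫ φ² = L Q`. The second condition lets the remaining
  -- surplus, halved by the lower bound `1/2` on the weight, beat the derivative term.
  obtain ⟨L, hL1, hL2, hL3, hL4⟩ : ∃ L : ℝ, 1 ≤ L ∧ 4 * A * P / (η * Q) < L ∧
      |C| * Real.exp (2 * -L) < η / 4 ∧ 1 / 2 < Real.exp (-b * Real.exp (m * -L)) := by
    have t0 : ∀ s : ℝ, 0 < s → Tendsto (fun L : ℝ => Real.exp (s * -L)) atTop (𝓝 0) := by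
      intro s hs
      refine Real.tendsto_exp_atBot.comp ?_
      exact tendsto_neg_atTop_atBot.const_mul_atBot hs
    have t1 : Tendsto (fun L : ℝ => |C| * Real.exp (2 * -L)) atTop (𝓝 0) := by
      simpa using (t0 2 two_pos).const_mul |C|
    have t2 : Tendsto (fun L : ℝ => Real.exp (-b * Real.exp (m * -L))) atTop (𝓝 1) := by
      have := (Real.continuous_exp.tendsto _).comp ((t0 m hm).const_mul (-b))
      simpa [Function.comp_def] using this
    exact ((eventually_ge_atTop 1).and ((eventually_gt_atTop _).and
      ((t1.eventually_lt_const (by positivity)).and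
        (t2.eventually_const_lt (by norm_num))))).exists
  have hL0 : 0 < L := by linarith
  set φ : ℝ → ℝ := fun t => Φ (t / L) with hφ
  have hφs : ContDiff ℝ (⊤ : ℕ∞) φ := hΦs.comp (contDiff_id.div_const L)
  have hφd : ∀ t, deriv φ t = deriv Φ (t / L) / L := by
    intro t
    have h1 : HasDerivAt Φ (deriv Φ (t / L)) (t / L) :=
      (hΦs.differentiable (by simp) _).hasDerivAt
    exact (h1.comp t ((hasDerivAt_id t).div_const L)).deriv.trans (mul_one_div _ _)
  have hout : ∀ t, t ∉ Set.Icc (-2 * L) (-L) → φ t = 0 ∧ deriv φ t = 0 := by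
    intro t ht
    have : t / L ∉ Set.Icc (-2 : ℝ) (-1) := by
      rw [Set.mem_Icc, le_div_iff₀ hL0, div_le_iff₀ hL0]
      rintro ⟨h1, h2⟩
      exact ht ⟨h1, by linarith⟩
    rw [hφd]
    simp [hφ, hΦ0 _ this]
  have hφ'c : Continuous (deriv φ) := hφs.continuous_deriv (by simp)
  have hφc := hφs.continuous
  have hI : ∀ q : ℝ → ℝ, Continuous q → (∀ t, t ∉ Set.Icc (-2 * L) (-L) → q t = 0) →
      Integrable q := fun q hq hq0 =>
    hq.integrable_of_hasCompactSupport (HasCompactSupport.intro isCompact_Icc hq0)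
  have hω : Continuous fun t => Real.exp (-b * Real.exp (m * t)) := by fun_prop
  have hI1 := hI (fun t => Real.exp (-b * Real.exp (m * t)) * (deriv φ t - l * φ t) ^ 2)
    (hω.mul ((hφ'c.sub (continuous_const.mul hφc)).pow 2)) fun t ht => by simp [hout t ht]
  have hI2 := hI (fun t => Real.exp (-b * Real.exp (m * t)) * (Real.exp (2 * t) * φ t ^ 2))
    (hω.mul ((by fun_prop : Continuous fun t : ℝ => Real.exp (2 * t)).mul (hφc.pow 2)))
    fun t ht => by simp [hout t ht]
  have hI3 := hI (fun t => Real.exp (-b * Real.exp (m * t)) * φ t ^ 2)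
    (hω.mul (hφc.pow 2)) fun t ht => by simp [hout t ht]
  have hI4 := hI (fun t => deriv φ t ^ 2) (hφ'c.pow 2) fun t ht => by simp [hout t ht]
  have hI5 := hI (fun t => φ t ^ 2) (hφc.pow 2) fun t ht => by simp [hout t ht]
  refine ⟨φ, L, hL0, hφs, fun t ht => (hout t fun h => absurd h.1 (not_le.2 ht)).1,
    fun t ht => (hout t fun h => absurd h.2 (not_le.2 ht)).1, ?_⟩
  have hJ4 : ∫ t, deriv φ t ^ 2 = P / L := by
    simp_rw [hφd, div_pow]
    rw [integral_div, Measure.integral_comp_div (fun t => deriv Φ t ^ 2) L, abs_of_pos hL0,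
      smul_eq_mul, ← hP]
    field_simp
  have hJ5 : ∫ t, φ t ^ 2 = L * Q := by
    rw [Measure.integral_comp_div (fun t => Φ t ^ 2) L, abs_of_pos hL0, smul_eq_mul]
  have hkey : ∫ t, (Real.exp (-b * Real.exp (m * t)) * (deriv φ t - l * φ t) ^ 2 +
        C * (Real.exp (-b * Real.exp (m * t)) * (Real.exp (2 * t) * φ t ^ 2)) -
        c * (Real.exp (-b * Real.exp (m * t)) * φ t ^ 2)) ≤
      ∫ t, (A * deriv φ t ^ 2 - η / 4 * φ t ^ 2) := by
    refine integral_mono ((hI1.add (hI2.const_mul C)).sub (hI3.const_mul c))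
      ((hI4.const_mul A).sub (hI5.const_mul _)) fun t => ?_
    simp only
    rcases le_or_gt t (-L) with ht | ht
    · set p := deriv φ t
      set q := φ t
      set ω := Real.exp (-b * Real.exp (m * t))
      have w1 : 1 / 2 ≤ ω := by
        refine hL4.le.trans (Real.exp_le_exp.2 ?_)
        have : Real.exp (m * t) ≤ Real.exp (m * -L) := by gcongr
        nlinarith
      have w2 : ω ≤ 1 := Real.exp_le_one_iff.2 (by
        have := Real.exp_pos (m * t)
        nlinarith)
      have w3 : C * Real.exp (2 * t) ≤ η / 4 := by
        calc C * Real.exp (2 * t) ≤ |C| * Real.exp (2 * -L) := by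
              gcongr
              exact le_abs_self C
          _ ≤ η / 4 := hL3.le
      have s1 : (p - l * q) ^ 2 ≤ A * p ^ 2 + (l ^ 2 + η / 4) * q ^ 2 := by
        have : A * p ^ 2 + (l ^ 2 + η / 4) * q ^ 2 - (p - l * q) ^ 2 =
            (4 * l * p + η * q) ^ 2 / (4 * η) := by
          rw [hA]; field_simp; ring
        have h2 : 0 ≤ (4 * l * p + η * q) ^ 2 / (4 * η) := by positivity
        linarith
      have s2 : C * Real.exp (2 * t) * q ^ 2 ≤ η / 4 * q ^ 2 :=
        mul_le_mul_of_nonneg_right w3 (sq_nonneg q)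
      have s3 : (p - l * q) ^ 2 + C * Real.exp (2 * t) * q ^ 2 - c * q ^ 2 ≤
          A * p ^ 2 - η / 2 * q ^ 2 := by
        have : c = l ^ 2 + η := by rw [hη]; ring
        rw [this]; linarith
      calc ω * (p - l * q) ^ 2 + C * (ω * (Real.exp (2 * t) * q ^ 2)) - c * (ω * q ^ 2)
          = ω * ((p - l * q) ^ 2 + C * Real.exp (2 * t) * q ^ 2 - c * q ^ 2) := by ring
        _ ≤ ω * (A * p ^ 2 - η / 2 * q ^ 2) := mul_le_mul_of_nonneg_left s3 (by linarith)
        _ = ω * (A * p ^ 2) - ω * (η / 2 * q ^ 2) := by ring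
        _ ≤ 1 * (A * p ^ 2) - 1 / 2 * (η / 2 * q ^ 2) := by gcongr
        _ = _ := by ring
    · have := hout t fun h => absurd h.2 (not_le.2 ht)
      simp [this]
  have e1 : ∫ t, (Real.exp (-b * Real.exp (m * t)) * (deriv φ t - l * φ t) ^ 2 +
        C * (Real.exp (-b * Real.exp (m * t)) * (Real.exp (2 * t) * φ t ^ 2)) -
        c * (Real.exp (-b * Real.exp (m * t)) * φ t ^ 2)) =
      (∫ t, Real.exp (-b * Real.exp (m * t)) * (deriv φ t - l * φ t) ^ 2) +
        C * (∫ t, Real.exp (-b * Real.exp (m * t)) * (Real.exp (2 * t) * φ t ^ 2)) -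
      c * ∫ t, Real.exp (-b * Real.exp (m * t)) * φ t ^ 2 := by
    have hI12 : Integrable fun t =>
        Real.exp (-b * Real.exp (m * t)) * (deriv φ t - l * φ t) ^ 2 +
        C * (Real.exp (-b * Real.exp (m * t)) * (Real.exp (2 * t) * φ t ^ 2)) :=
      hI1.add (hI2.const_mul C)
    rw [integral_sub hI12 (hI3.const_mul c),
      integral_add hI1 (hI2.const_mul C), integral_const_mul, integral_const_mul]
  rw [e1, integral_sub (hI4.const_mul A) (hI5.const_mul _), integral_const_mul,
    integral_const_mul, hJ4, hJ5] at hkey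
  have hfin : A * (P / L) - η / 4 * (L * Q) < 0 := by
    rw [div_lt_iff₀ (by positivity)] at hL2
    have h1 : A * (P / L) ≤ A * P := by
      gcongr
      exact div_le_self hP0 hL1
    nlinarith
  linarith

theorem hardyConst_optimal (hN : 3 ≤ N) {β b m : ℝ} (hβ : β < (N : ℝ) - 2)
    (hb : 0 ≤ b) (hm : 0 < m) (c : ℝ) (hc : hardyConst (N - β) < c) (C : ℝ) :
    ∃ (u : EuclideanSpace ℝ (Fin N) → ℝ)
      (g : EuclideanSpace ℝ (Fin N) → EuclideanSpace ℝ (Fin N)),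
      ContDiff ℝ (⊤ : ℕ∞) u ∧ HasCompactSupport u ∧
      MemWeightedH1 (weightMeasure N β b m) u g ∧
        ∫ x, ‖g x‖ ^ 2 ∂(weightMeasure N β b m) +
            C * ∫ x, u x ^ 2 ∂(weightMeasure N β b m) <
          c * ∫ x, u x ^ 2 / ‖x‖ ^ 2 ∂(weightMeasure N β b m) := by
  have : NeZero N := ⟨by omega⟩
  set l : ℝ := ((N : ℝ) - β - 2) / 2 with hl
  have hl0 : 0 < l := by rw [hl]; linarith
  obtain ⟨φ, L, hL, hφ, hφ0, hφ1, hlt⟩ := exists_log_profile hl0 hc C hb hm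
  -- The indicator is needed because `Real.log` is even, so the formula alone need not vanish for
  -- negative `r`.
  set k : ℝ → ℝ := (Set.Ioi 0).indicator fun r => r ^ (-l) * φ (Real.log r) with hkdef
  have hkpos : ∀ r, 0 < r → k r = r ^ (-l) * φ (Real.log r) := fun r hr =>
    Set.indicator_of_mem (Set.mem_Ioi.2 hr) _
  have hk0 : ∀ r < Real.exp (-2 * L), k r = 0 := by
    intro r hr
    by_cases h : 0 < r
    · rw [hkpos r h, hφ0 _ ((Real.log_lt_iff_lt_exp h).2 hr), mul_zero]
    · exact Set.indicator_of_notMem h _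
  have hk1 : ∀ r, Real.exp (-L) < r → k r = 0 := by
    intro r hr
    have h : 0 < r := (Real.exp_pos _).trans hr
    rw [hkpos r h, hφ1 _ ((Real.lt_log_iff_exp_lt h).2 hr), mul_zero]
  have hev : ∀ r, 0 < r → k =ᶠ[𝓝 r] fun r => r ^ (-l) * φ (Real.log r) := fun r hr => by
    filter_upwards [Ioi_mem_nhds hr] with s hs using hkpos s hs
  have hk : ContDiff ℝ (⊤ : ℕ∞) k := by
    rw [contDiff_iff_contDiffAt]
    intro r
    rcases lt_or_ge r (Real.exp (-2 * L)) with h1 | h1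
    · have : k =ᶠ[𝓝 r] fun _ => 0 := by
        filter_upwards [Iio_mem_nhds h1] with s hs using hk0 s hs
      exact contDiffAt_const.congr_of_eventuallyEq this
    · have hr : 0 < r := (Real.exp_pos _).trans_le h1
      exact ((Real.contDiffAt_rpow_const_of_ne hr.ne').mul
        (hφ.contDiffAt.comp r (Real.contDiffAt_log.2 hr.ne'))).congr_of_eventuallyEq (hev r hr)
  have hkd : ∀ r, 0 < r →
      deriv k r = r ^ (-l - 1) * (deriv φ (Real.log r) - l * φ (Real.log r)) := by
    intro r hr
    rw [(hev r hr).deriv_eq]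
    have h1 : HasDerivAt (fun r : ℝ => r ^ (-l)) (-l * r ^ (-l - 1)) r :=
      Real.hasDerivAt_rpow_const (Or.inl hr.ne')
    have h2 : HasDerivAt (fun r => φ (Real.log r)) (deriv φ (Real.log r) * r⁻¹) r :=
      ((hφ.differentiable (by simp) _).hasDerivAt).comp r (Real.hasDerivAt_log hr.ne')
    refine (h1.mul h2).deriv.trans ?_
    rw [Real.rpow_sub_one hr.ne']
    field_simp
    ring
  have hM := memWeightedH1_radial (N := N) β b m hk (Real.exp_pos _) hk0 hk1
  refine ⟨fun x => k ‖x‖, fun x => (deriv k ‖x‖ / ‖x‖) • x,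
    contDiff_comp_norm hk (Real.exp_pos _) hk0,
    hasCompactSupport_of_forall_norm fun x => hk1 ‖x‖, hM, ?_⟩
  -- With this exponent the powers of `e^t` cancel in the gradient and Hardy integrals, and `e^(2t)`
  -- remains in the `L²` integral.
  have hN2 : (N : ℝ) - β = 2 * l + 2 := by rw [hl]; ring
  have hd0 : deriv k 0 = 0 := by
    have : k =ᶠ[𝓝 0] fun _ => 0 := by
      filter_upwards [Iio_mem_nhds (Real.exp_pos (-2 * L))] with s hs using hk0 s hs
    rw [this.deriv_eq]; simp
  have hgn : ∀ x : 𝔼, ‖(deriv k ‖x‖ / ‖x‖) • x‖ ^ 2 = deriv k ‖x‖ ^ 2 := fun x =>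
    norm_div_norm_smul_sq fun h => by simp [h, hd0]
  simp_rw [hgn]
  rw [integral_weightMeasure_radial β b m (fun r => deriv k r ^ 2),
    integral_weightMeasure_radial β b m (fun r => k r ^ 2),
    integral_weightMeasure_radial β b m (fun r => k r ^ 2 / r ^ 2)]
  have hexp : ∀ t : ℝ, Real.exp t ^ (-l) = Real.exp (-l * t) := fun t => by
    rw [← Real.exp_mul, mul_comm]
  have e1 : ∀ t, Real.exp ((N - β) * t) * deriv k (Real.exp t) ^ 2 =
      (deriv φ t - l * φ t) ^ 2 := fun t => by
    rw [hkd _ (Real.exp_pos t), Real.log_exp, ← Real.exp_mul, mul_pow, ← Real.exp_nat_mul,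
      ← mul_assoc, ← Real.exp_add, hN2]
    have : (2 * l + 2) * t + ((2 : ℕ) : ℝ) * (t * (-l - 1)) = 0 := by push_cast; ring
    rw [this]; simp
  have e2 : ∀ t, Real.exp ((N - β) * t) * k (Real.exp t) ^ 2 = Real.exp (2 * t) * φ t ^ 2 :=
    fun t => by
      rw [hkpos _ (Real.exp_pos t), Real.log_exp, hexp, mul_pow, ← Real.exp_nat_mul,
        ← mul_assoc, ← Real.exp_add, hN2]
      congr 2; push_cast; ring
  have e3 : ∀ t, Real.exp ((N - β) * t) * (k (Real.exp t) ^ 2 / Real.exp t ^ 2) = φ t ^ 2 :=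
    fun t => by
      rw [← mul_div_assoc, e2, ← Real.exp_nat_mul]
      push_cast
      rw [mul_comm, mul_div_cancel_right₀ _ (Real.exp_pos _).ne']
  simp_rw [e1, e2, e3]
  have hκ : 0 < (N : ℝ) * volume.real (Metric.ball (0 : 𝔼) 1) := by
    have h1 : 0 < volume.real (Metric.ball (0 : 𝔼) 1) :=
      ENNReal.toReal_pos (Metric.measure_ball_pos volume _ one_pos).ne' measure_ball_lt_top.ne
    have h2 : (0 : ℝ) < N := by exact_mod_cast (by omega : 0 < N)
    positivity
  have := mul_lt_mul_of_pos_left hlt hκ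
  linarith

end Optimality

theorem mainTheorem9 (N : ℕ) (hN : 3 ≤ N) (β b m : ℝ) (hβ : β < (N : ℝ) - 2)
    (hb : 0 ≤ b) (hm : 0 < m) :
    -- the inequality on `H^1_μ`
    (∃ C : ℝ, 0 ≤ C ∧
      ∀ (u : EuclideanSpace ℝ (Fin N) → ℝ)
        (g : EuclideanSpace ℝ (Fin N) → EuclideanSpace ℝ (Fin N)),
        MemWeightedH1 (weightMeasure N β b m) u g →
          Integrable (fun x => u x ^ 2 / ‖x‖ ^ 2) (weightMeasure N β b m) ∧
          hardyConst (N - β) * ∫ x, u x ^ 2 / ‖x‖ ^ 2 ∂(weightMeasure N β b m) ≤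
            ∫ x, ‖g x‖ ^ 2 ∂(weightMeasure N β b m) +
              C * ∫ x, u x ^ 2 ∂(weightMeasure N β b m)) ∧
    -- the constant is the best one, even among smooth compactly supported functions
    (∀ c : ℝ, hardyConst (N - β) < c → ∀ C : ℝ,
      ∃ (u : EuclideanSpace ℝ (Fin N) → ℝ)
        (g : EuclideanSpace ℝ (Fin N) → EuclideanSpace ℝ (Fin N)),
        ContDiff ℝ (⊤ : ℕ∞) u ∧ HasCompactSupport u ∧
        MemWeightedH1 (weightMeasure N β b m) u g ∧
          ∫ x, ‖g x‖ ^ 2 ∂(weightMeasure N β b m) +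
              C * ∫ x, u x ^ 2 ∂(weightMeasure N β b m) <
            c * ∫ x, u x ^ 2 / ‖x‖ ^ 2 ∂(weightMeasure N β b m)) :=
  ⟨weighted_hardy_inequality hβ hb hm, hardyConst_optimal hN hβ hb hm⟩
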